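/- Let $Z_0$ be a compact metrizable Abelian group, let $A$ be an Abelian Lie group (a topological Abelian group that is second-countable and locally Euclidean, not necessarily connected or compactly generated), and let $d\ge 2$ be an integer. Put $Z:=Z_0^d$. Let $U_1,\dots,U_d\le Z$ be the coordinate copies of $Z_0$, $U_i:=\{(0,\dots,0,z,0,\dots,0): z\in Z_0\}$ with $z$ in position $i$, and let $U_{d+1}:=\{(z,z,\dots,z): z\in Z_0\}$ be the diagonal copy. Let $\mathcal F(Z,A)$ be the Abelian group of measurable functions $Z\to A$ modulo agreement almost everywhere for Haar measure. For $w\in Z$ let $d_wf(z):=f(z-w)-f(z)$. For $e=\{i_1<\dots<i_\ell\}\subseteq[d+1]:=\{1,\dots,d+1\}$ let $$M_e:=\{f\in\mathcal F(Z,A):\ d_{u_{i_1}}\cdots d_{u_{i_\ell}}f=0\ \text{ for all } u_{i_1}\in U_{i_1},\dots,u_{i_\ell}\in U_{i_\ell}\},$$ so that $M_{[d+1]}$ is the group of solutions of the partial difference equation associated to $(U_1,\dots,U_{d+1})$. Let $M^{(d)}:=\bigoplus_{|a|=d}M_a$ (over $d$-element subsets $a$ of $[d+1]$) and let $\partial_{d+1}:M^{(d)}\to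 M_{[d+1]}$ be the map $\partial_{d+1}\big((m_a)_a\big):=\sum_{j=1}^{d+1}(-1)^{j-1}m_{[d+1]\setminus\{j\}}$; its image is the group of degenerate solutions. Let $\mathrm H^p_{\mathrm m}(Z_0,A)$ be the $p$-th measurable cohomology group of $Z_0$ with coefficients in $A$ (with trivial action): the $p$-th cohomology group of the complex with terms $\mathcal F(Z_0^p,A)$, $p\ge 0$, and differentials $$df(z_1,\dots,z_{p+1}):=f(z_2,\dots,z_{p+1})+\sum_{i=1}^p(-1)^if(z_1,\dots,z_i+z_{i+1},\dots,z_{p+1})+(-1)^{p+1}f(z_1,\dots,z_p).$$ Then: 1. The tuple $(U_1,\dots,U_{d+1})$ is almost linearly independent: whenever $e\subsetneq[d+1]$, $u_i\in U_i$ for $i\in e$, and $\sum_{i\in e}u_i=0$, all $u_i$ vanish. Moreover any $d$ of these $d+1$ subgroups give an isomorphism of topological groups $Z_0^d\cong Z$: if $\phi_i:Z_0\to U_i$ denotes the evident parametrization, then for every $i\in[d+1]$ the map $(w_j)_{j\ne i}\mapsto\sum_{j\neq i}\phi_j(w_j)$ is such an isomorphism. 2. There is an isomorphism of Abelian groups $$M_{[d+1]}/\partial_{d+1}(M^{(d)})\;\cong\;\mathrm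 H^d_{\mathrm m}(Z_0,A).$$ -/

import Mathlib

open MeasureTheory

noncomputable section

namespace PDE

/-! ### Measurable functions on a compact Abelian group -/

/-- `X` is locally Euclidean: every point has an open neighbourhood homeomorphic to an open
subset of some `ℝⁿ`. An *Abelian Lie group* is a second-countable locally Euclidean
topological Abelian group (it need not be connected or compactly generated). -/
def IsLocallyEuclidean (X : Type*) [TopologicalSpace X] : Prop :=
  ∀ x : X, ∃ (n : ℕ) (e : OpenPartialHomeomorph X (EuclideanSpace ℝ (Fin n))), x ∈ e.source

section Functions

variable (G : Type*) [AddCommGroup G] [TopologicalSpace G] [IsTopologicalAddGroup G]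
  [CompactSpace G] [MeasurableSpace G] [BorelSpace G]

/-- The Haar probability measure of a compact Abelian group. -/
def haarProb : Measure G := Measure.addHaarMeasure ⊤

instance : (haarProb G).IsAddHaarMeasure := by
  unfold haarProb; infer_instance

instance : IsProbabilityMeasure (haarProb G) :=
  ⟨by simpa [haarProb] using
    Measure.addHaarMeasure_self (G := G) (K₀ := (⊤ : TopologicalSpace.PositiveCompacts G))⟩

variable (A : Type*) [AddCommGroup A] [TopologicalSpace A] [IsTopologicalAddGroup A]

/-- `𝓕(G, A)`: measurable functions `G → A` modulo agreement Haar-almost everywhere. (For `A`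
second countable and metrizable, almost-everywhere strong measurability, which Mathlib uses here,
is the same as almost-everywhere agreement with a Borel function.) -/
abbrev MeasFun : Type _ := G →ₘ[haarProb G] A

variable {G}

/-- Composition `f ↦ f ∘ φ` with a measure-preserving map, as a group homomorphism. -/
def pullback {H : Type*} [AddCommGroup H] [TopologicalSpace H] [IsTopologicalAddGroup H]
    [CompactSpace H] [MeasurableSpace H] [BorelSpace H] (φ : G → H)
    (hφ : MeasurePreserving φ (haarProb G) (haarProb H)) : MeasFun H A →+ MeasFun G A where
  toFun f := f.compMeasurePreserving φ hφ
  map_zero' := rfl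
  map_add' f g := by
    induction f using AEEqFun.induction_on with | _ f hf =>
    induction g using AEEqFun.induction_on with | _ g hg =>
    rfl

variable {A}

/-- The translation operator `(R_w f)(z) = f(z - w)`. -/
def translate (w : G) : MeasFun G A →+ MeasFun G A :=
  pullback A (fun z => z - w) (measurePreserving_sub_right (haarProb G) w)

/-- The differencing operator `(d_w f)(z) = f(z - w) - f(z)`. -/
def diff (w : G) : AddMonoid.End (MeasFun G A) :=
  translate w - AddMonoidHom.id _

theorem translate_comm (v w : G) (f : MeasFun G A) :
    translate v (translate w f) = translate w (translate v f) := by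
  induction f using AEEqFun.induction_on with | _ f hf =>
  refine AEEqFun.mk_eq_mk.2 (Filter.Eventually.of_forall fun z => congrArg f ?_)
  change z - v - w = z - w - v
  abel

theorem diff_commute (v w : G) :
    Commute (diff v : AddMonoid.End (MeasFun G A)) (diff w) := by
  refine AddMonoidHom.ext fun f => ?_
  change translate v (translate w f - f) - (translate w f - f)
    = translate w (translate v f - f) - (translate v f - f)
  rw [map_sub, map_sub, translate_comm]
  abel

/-! ### Partial difference equations and the complex of their solution modules -/

variable {k : ℕ}

/-- `d_{u_{i₁}} ⋯ d_{u_{i_ℓ}}` for `e = {i₁ < ⋯ < i_ℓ}`. -/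
def iterDiff (u : Fin k → G) (e : Finset (Fin k)) : AddMonoid.End (MeasFun G A) :=
  (e.sort.map fun i => diff (u i)).prod

/-- The solution module `M_e` of the partial difference equation associated to the tuple
`(U_i)_{i ∈ e}`: all `f` with `d_{u_{i₁}} ⋯ d_{u_{i_ℓ}} f = 0` (almost everywhere) for all
`u_{i₁} ∈ U_{i₁}, …, u_{i_ℓ} ∈ U_{i_ℓ}`, where `e = {i₁ < ⋯ < i_ℓ}`. -/
def solutions (A : Type*) [AddCommGroup A] [TopologicalSpace A] [IsTopologicalAddGroup A]
    (U : Fin k → AddSubgroup G) (e : Finset (Fin k)) : AddSubgroup (MeasFun G A) where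
  carrier := {f | ∀ u : Fin k → G, (∀ i ∈ e, u i ∈ U i) → iterDiff u e f = 0}
  zero_mem' _ _ := map_zero _
  add_mem' hf hg u hu := by rw [map_add, hf u hu, hg u hu, add_zero]
  neg_mem' hf u hu := by rw [map_neg, hf u hu, neg_zero]

theorem iterDiff_of_subset (u : Fin k → G) {a e : Finset (Fin k)} (h : a ⊆ e) :
    (iterDiff u e : AddMonoid.End (MeasFun G A)) = iterDiff u (e \ a) * iterDiff u a := by
  unfold iterDiff
  rw [← List.prod_append, ← List.map_append]
  refine List.Perm.prod_eq' (List.Perm.map _ ?_) ?_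
  · rw [← Multiset.coe_eq_coe, ← Multiset.coe_add, Finset.sort_eq, Finset.sort_eq,
      Finset.sort_eq, Finset.sdiff_val, Multiset.sub_add_cancel (Finset.val_le_iff.2 h)]
  · rw [List.pairwise_map]
    exact List.pairwise_of_forall fun _ _ => diff_commute _ _

theorem solutions_mono (U : Fin k → AddSubgroup G) {a e : Finset (Fin k)} (h : a ⊆ e) :
    solutions A U a ≤ solutions A U e := fun f hf u hu => by
  rw [iterDiff_of_subset u h]
  change iterDiff u (e \ a) (iterDiff u a f) = 0
  rw [hf u fun i hi => hu i (h hi), map_zero]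

/-- `M^{(ℓ)} = ⨁_{|a| = ℓ} M_a`, the direct sum over all `ℓ`-element subsets `a` of the index
set. -/
abbrev SolutionSum (A : Type*) [AddCommGroup A] [TopologicalSpace A] [IsTopologicalAddGroup A]
    (U : Fin k → AddSubgroup G) (l : ℕ) : Type _ :=
  (a : {a : Finset (Fin k) // a.card = l}) → solutions A U a.1

/-- The boundary map `∂_{ℓ+1} : M^{(ℓ)} → M^{(ℓ+1)}`: for `e = {i₁ < ⋯ < i_{ℓ+1}}`,
`(∂_{ℓ+1} m)_e = ∑_j (-1)^(j-1) m_{e ∖ {i_j}}`. The exponent `j - 1` is the number of elements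
of `e` below `i_j`. -/
def boundary (A : Type*) [AddCommGroup A] [TopologicalSpace A] [IsTopologicalAddGroup A]
    (U : Fin k → AddSubgroup G) (l : ℕ) : SolutionSum A U l →+ SolutionSum A U (l + 1) where
  toFun m e := ∑ i : {i // i ∈ e.1}, (-1 : ℤ) ^ (e.1.filter (· < i.1)).card •
    AddSubgroup.inclusion (solutions_mono (A := A) U (e.1.erase_subset i.1))
      (m ⟨e.1.erase i.1, by rw [Finset.card_erase_of_mem i.2, e.2, Nat.add_sub_cancel]⟩)
  map_zero' := by funext e; simp
  map_add' m m' := by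
    funext e
    simp only [Pi.add_apply, map_add, smul_add, Finset.sum_add_distrib]

/-- The projection of `M^{(k)}` to its only summand `M_{[k]}` (an isomorphism). -/
def topEval (A : Type*) [AddCommGroup A] [TopologicalSpace A] [IsTopologicalAddGroup A]
    (U : Fin k → AddSubgroup G) : SolutionSum A U k →+ solutions A U Finset.univ :=
  Pi.evalAddMonoidHom (fun a : {a : Finset (Fin k) // a.card = k} => solutions A U a.1)
    ⟨Finset.univ, by simp⟩

/-- For a `(d+1)`-tuple of subgroups: the degenerate solutions `∂_{d+1}(M^{(d)}) ≤ M_{[d+1]}`. -/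
def degenerate (A : Type*) [AddCommGroup A] [TopologicalSpace A] [IsTopologicalAddGroup A]
    {d : ℕ} (U : Fin (d + 1) → AddSubgroup G) :
    AddSubgroup (solutions A U Finset.univ) :=
  ((topEval A U).comp (boundary A U d)).range

end Functions

/-! ### Linear independence of subgroups -/

/-- The subgroups `U_i`, `i ∈ e`, are linearly independent: a sum of elements `u_i ∈ U_i`
vanishes only if every `u_i` vanishes. -/
def SubgroupsIndependent {G ι : Type*} [AddCommGroup G] (U : ι → AddSubgroup G)
    (e : Finset ι) : Prop :=
  ∀ u : ι → G, (∀ i ∈ e, u i ∈ U i) → ∑ i ∈ e, u i = 0 → ∀ i ∈ e, u i = 0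

/-- Every proper sub-tuple is linearly independent. -/
def SubgroupsAlmostIndependent {G ι : Type*} [AddCommGroup G] [Fintype ι]
    (U : ι → AddSubgroup G) : Prop :=
  ∀ e : Finset ι, e ≠ Finset.univ → SubgroupsIndependent U e

/-- The `d` coordinate embeddings `Z₀ → Z₀ᵈ`, followed by the diagonal embedding. -/
def actingHom (Z₀ : Type*) [AddCommGroup Z₀] (d : ℕ) : Fin (d + 1) → Z₀ →+ (Fin d → Z₀) :=
  Fin.lastCases (AddMonoidHom.mk' (fun z _ => z) fun _ _ => rfl)
    (fun i => AddMonoidHom.single (fun _ : Fin d => Z₀) i)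

/-- `U_1, …, U_d` are the coordinate copies of `Z₀` in `Z₀ᵈ` and `U_{d+1}` is the diagonal. -/
def actingSubgroup (Z₀ : Type*) [AddCommGroup Z₀] (d : ℕ) (i : Fin (d + 1)) :
    AddSubgroup (Fin d → Z₀) :=
  (actingHom Z₀ d i).range

/-! ### Measurable group cohomology -/

section Cohomology

variable (Z₀ : Type*) [AddCommGroup Z₀]

/-- The face maps `Z₀^{p+1} → Z₀^p` of the bar resolution: face `0` is
`(z_1, …, z_{p+1}) ↦ (z_2, …, z_{p+1})`, face `i` for `1 ≤ i ≤ p` replaces `z_i, z_{i+1}` by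
`z_i + z_{i+1}`, and face `p + 1` drops `z_{p+1}`. -/
def faceMap (p : ℕ) : Fin (p + 2) → (Fin (p + 1) → Z₀) → (Fin p → Z₀) :=
  Fin.cases Fin.tail fun j => Fin.contractNth j (· + ·)

theorem faceMap_zero_fun (p : ℕ) (j : Fin (p + 2)) : faceMap Z₀ p j 0 = 0 := by
  induction j using Fin.cases with
  | zero => rfl
  | succ j => funext k; simp [faceMap, Fin.contractNth]

theorem faceMap_add (p : ℕ) (j : Fin (p + 2)) (x y : Fin (p + 1) → Z₀) :
    faceMap Z₀ p j (x + y) = faceMap Z₀ p j x + faceMap Z₀ p j y := by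
  induction j using Fin.cases with
  | zero => rfl
  | succ j =>
    funext k
    simp only [faceMap, Fin.cases_succ, Fin.contractNth, Pi.add_apply]
    split_ifs <;> abel

theorem faceMap_surjective (p : ℕ) (j : Fin (p + 2)) :
    Function.Surjective (faceMap Z₀ p j) := by
  induction j using Fin.cases with
  | zero => exact fun h => ⟨Fin.cons 0 h, Fin.tail_cons (α := fun _ => Z₀) 0 h⟩
  | succ j =>
    refine fun h => ⟨j.insertNth 0 h, ?_⟩
    funext k
    simp only [faceMap, Fin.cases_succ]
    rcases eq_or_ne (j : ℕ) k with hk | hk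
    · have h1 : j = k.castSucc := Fin.ext hk
      have h2 : k.succ = j.succAbove k := by rw [h1, Fin.succAbove_castSucc_self]
      rw [Fin.contractNth_apply_of_eq _ _ _ _ hk.symm, h2, Fin.insertNth_apply_succAbove,
        ← h1, Fin.insertNth_apply_same, zero_add]
    · rw [Fin.contractNth_apply_of_ne _ _ _ _ hk, Fin.insertNth_apply_succAbove]

variable [TopologicalSpace Z₀] [IsTopologicalAddGroup Z₀]

theorem faceMap_continuous (p : ℕ) (j : Fin (p + 2)) : Continuous (faceMap Z₀ p j) := by
  induction j using Fin.cases with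
  | zero => exact continuous_pi fun k => continuous_apply _
  | succ j =>
    refine continuous_pi fun k => ?_
    simp only [faceMap, Fin.cases_succ, Fin.contractNth]
    split_ifs <;> fun_prop

variable [CompactSpace Z₀] [SecondCountableTopology Z₀] [MeasurableSpace Z₀] [BorelSpace Z₀]

theorem faceMap_measurePreserving (p : ℕ) (j : Fin (p + 2)) :
    MeasurePreserving (faceMap Z₀ p j) (haarProb (Fin (p + 1) → Z₀)) (haarProb (Fin p → Z₀)) :=
  AddMonoidHom.measurePreserving
    (f := (AddMonoidHom.mk' (faceMap Z₀ p j) (faceMap_add Z₀ p j)))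
    (faceMap_continuous Z₀ p j) (faceMap_surjective Z₀ p j) (by simp)

variable (A : Type*) [AddCommGroup A] [TopologicalSpace A] [IsTopologicalAddGroup A]

/-- The `A`-valued cochains `𝓒^p(Z₀, A) = 𝓕(Z₀^p, A)`. -/
abbrev Cochain (p : ℕ) : Type _ := MeasFun (Fin p → Z₀) A

/-- The differential of the inhomogeneous bar resolution for the trivial action of `Z₀` on `A`:
`df(z_1, …, z_{p+1}) = f(z_2, …, z_{p+1}) + ∑_{i=1}^p (-1)^i f(…, z_i + z_{i+1}, …)
+ (-1)^{p+1} f(z_1, …, z_p)`. -/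
def cobdry (p : ℕ) : Cochain Z₀ A p →+ Cochain Z₀ A (p + 1) :=
  ∑ j : Fin (p + 2), (-1 : ℤ) ^ (j : ℕ) •
    pullback A (faceMap Z₀ p j) (faceMap_measurePreserving Z₀ p j)

/-- The `p`-cocycles. -/
def cocycles (p : ℕ) : AddSubgroup (Cochain Z₀ A p) := (cobdry Z₀ A p).ker

/-- The `p`-coboundaries. -/
def coboundaries : (p : ℕ) → AddSubgroup (Cochain Z₀ A p)
  | 0 => ⊥
  | p + 1 => (cobdry Z₀ A p).range

/-- The measurable cohomology group `H^p_m(Z₀, A)`, for the trivial action of `Z₀` on `A`. -/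
abbrev MeasCohomology (p : ℕ) : Type _ :=
  cocycles Z₀ A p ⧸ (coboundaries Z₀ A p).addSubgroupOf (cocycles Z₀ A p)

end Cohomology

end PDE

end

open MeasureTheory

noncomputable section

namespace PDE

open Filter

set_option linter.unusedSectionVars false

/-! ### Pullbacks along surjective homomorphisms -/

section Pullback

variable {G H K : Type*} [AddCommGroup G] [TopologicalSpace G] [IsTopologicalAddGroup G]
  [CompactSpace G] [MeasurableSpace G] [BorelSpace G]
  [AddCommGroup H] [TopologicalSpace H] [IsTopologicalAddGroup H]
  [CompactSpace H] [MeasurableSpace H] [BorelSpace H]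
  [AddCommGroup K] [TopologicalSpace K] [IsTopologicalAddGroup K]
  [CompactSpace K] [MeasurableSpace K] [BorelSpace K]
  {A : Type*} [AddCommGroup A] [TopologicalSpace A] [IsTopologicalAddGroup A]

/-! Write `δ^i` for the coface maps and number the acting subgroups from 0 to `d`. A cochain on
`Z₀^d` is read in homogeneous coordinates `(g_0, …, g_d)` normalised by `g_d = 0` (`baseHom`). The
`i`-th face map then deletes `g_i`, and its kernel is exactly the `i`-th acting subgroup; for `i =
d` it is the diagonal, because a change of `g_d` followed by renormalisation translates all other
coordinates. Functions invariant under an acting subgroup are thus the image of one coface map, and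
everything becomes a question about sums of such images.

(a) A function killed by all mixed differences along independent axes is a sum of functions each
independent of one of these coordinates (`mem_coordSum_of_iterVanish`). Hence the degenerate
solutions are the sum of all the coface images in degree `d` (`map_degenerate_actingSubgroup`).

(b) A function `f`, coming from a cochain `φ`, is a solution iff its differences along the diagonal
are killed by the coordinate differences. In homogeneous coordinates `(z, w, 0)`, the function `f(z
- (w, …, w)) - f(z)` is `δ^{d+1}φ - δ^dφ`, so by (a) the condition is that it lies in the sum of the
images of `δ^0, …, δ^{d-1}` (`basePull_mem_solutions_iff`). Equivalently, the coboundary of `φ` lies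
there.

(c) The sums of images of all cofaces except the last form an acyclic subcomplex in degrees at least
2 (`exists_cobdry_eq`). The top coface is eliminated repeatedly, with a contraction that gives one
homogeneous coordinate a generic value. Measurable classes cannot be evaluated at a point, so
generic values are germs along the almost-everywhere filter.

By (b) cocycles are solutions. If `φ` gives a solution, its coboundary is closed in the subcomplex,
hence is the coboundary of a degenerate `y`, and `φ - y` is a cocycle in the same class. A
degenerate cocycle is, up to a coboundary, a closed element of the subcomplex, hence itself a
coboundary; conversely a coboundary is a sum of coface images. -/

theorem measurePreserving_of_surjective (φ : G →+ H) (hc : Continuous φ)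
    (hs : Function.Surjective φ) : MeasurePreserving φ (haarProb G) (haarProb H) :=
  φ.measurePreserving hc hs (by simp)

theorem pullback_pullback {φ : G → H} {ψ : H → K}
    (hφ : MeasurePreserving φ (haarProb G) (haarProb H))
    (hψ : MeasurePreserving ψ (haarProb H) (haarProb K)) (f : MeasFun K A) :
    pullback A φ hφ (pullback A ψ hψ f) = pullback A (ψ ∘ φ) (hψ.comp hφ) f := by
  induction f using AEEqFun.induction_on with | _ f hf => rfl

theorem pullback_congr {φ ψ : G → H} (h : φ = ψ)
    (hφ : MeasurePreserving φ (haarProb G) (haarProb H))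
    (hψ : MeasurePreserving ψ (haarProb G) (haarProb H)) (f : MeasFun H A) :
    pullback A φ hφ f = pullback A ψ hψ f := by
  subst h; rfl

theorem pullback_id {φ : G → G} (h : φ = id)
    (hφ : MeasurePreserving φ (haarProb G) (haarProb G)) (f : MeasFun G A) :
    pullback A φ hφ f = f := by
  subst h
  induction f using AEEqFun.induction_on with | _ f hf => rfl

theorem coeFn_pullback {φ : G → H} (hφ : MeasurePreserving φ (haarProb G) (haarProb H))
    (f : MeasFun H A) : ⇑(pullback A φ hφ f) =ᵐ[haarProb G] f ∘ φ :=
  AEEqFun.coeFn_compMeasurePreserving f hφ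

/-- The image of a pullback only grows when the kernel of the homomorphism shrinks. -/
theorem range_pullback_le [T2Space K] (ρ : G →+ H) (ρ' : G →+ K) (hc : Continuous ρ)
    (hc' : Continuous ρ') (hs : Function.Surjective ρ) (hs' : Function.Surjective ρ')
    (hk : ∀ x, ρ' x = 0 → ρ x = 0)
    (hm : MeasurePreserving ρ (haarProb G) (haarProb H))
    (hm' : MeasurePreserving ρ' (haarProb G) (haarProb K)) :
    (pullback A ρ hm).range ≤ (pullback A ρ' hm').range := by
  have hkey : ∀ x y, ρ' x = ρ' y → ρ x = ρ y := fun x y h => by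
    have := hk (x - y) (by rw [map_sub, h, sub_self])
    rwa [map_sub, sub_eq_zero] at this
  let κ : K →+ H := AddMonoidHom.mk' (fun y => ρ (Function.surjInv hs' y)) fun a b => by
    rw [← map_add]
    apply hkey
    rw [map_add, Function.surjInv_eq hs', Function.surjInv_eq hs', Function.surjInv_eq hs']
  have hκ : ∀ x, κ (ρ' x) = ρ x := fun x => hkey _ _ (Function.surjInv_eq hs' _)
  have hκc : Continuous κ := by
    -- The factor `κ` of `ρ` through `ρ'` is defined by arbitrary choices; its continuity comes from
    -- `ρ'` being a quotient map, as a closed surjection from a compact to a Hausdorff space.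
    have hq : Topology.IsQuotientMap ρ' := hc'.isClosedMap.isQuotientMap hc' hs'
    rw [hq.continuous_iff]
    have : (κ ∘ ρ' : G → H) = ρ := funext hκ
    rw [this]; exact hc
  have hκs : Function.Surjective κ := fun y => by
    obtain ⟨x, rfl⟩ := hs y
    exact ⟨_, hκ x⟩
  rintro _ ⟨h, rfl⟩
  refine ⟨pullback A κ (measurePreserving_of_surjective κ hκc hκs) h, ?_⟩
  rw [pullback_pullback]
  exact pullback_congr (funext hκ) _ _ _

end Pullback

/-! ### Germs of families of functions -/

section GermLift

variable {ι B C : Type*} [AddCommGroup B] [AddCommGroup C] {l : Filter ι}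

/-- The germs of families that eventually belong to a given subgroup. -/
def germLift (l : Filter ι) (D : AddSubgroup B) : AddSubgroup (Germ l B) where
  carrier := {g | g.LiftPred (· ∈ D)}
  zero_mem' := Germ.liftPred_const D.zero_mem
  add_mem' {a b} := by
    induction a using Germ.inductionOn with | _ a =>
    induction b using Germ.inductionOn with | _ b =>
    intro ha hb
    exact (Germ.liftPred_coe.1 ha).mp ((Germ.liftPred_coe.1 hb).mono fun x h1 h2 =>
      D.add_mem h2 h1)
  neg_mem' {a} := by
    induction a using Germ.inductionOn with | _ a =>
    intro ha
    exact (Germ.liftPred_coe.1 ha).mono fun x h => D.neg_mem h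

theorem coe_mem_germLift {D : AddSubgroup B} {f : ι → B} :
    (f : Germ l B) ∈ germLift l D ↔ ∀ᶠ x in l, f x ∈ D := Iff.rfl

theorem const_mem_germLift [NeBot l] {D : AddSubgroup B} {b : B} :
    ((b : B) : Germ l B) ∈ germLift l D ↔ b ∈ D :=
  Germ.liftPred_const_iff

/-- The homomorphism between groups of germs induced by a homomorphism. -/
def germMap (l : Filter ι) (φ : B →+ C) : Germ l B →+ Germ l C where
  toFun := Germ.map φ
  map_zero' := congrArg ((↑) : (ι → C) → Germ l C) (funext fun _ => φ.map_zero)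
  map_add' a b := by
    induction a using Germ.inductionOn with | _ a =>
    induction b using Germ.inductionOn with | _ b =>
    exact congrArg ((↑) : (ι → C) → Germ l C) (funext fun _ => φ.map_add _ _)

theorem germMap_coe (φ : B →+ C) (f : ι → B) :
    germMap l φ (f : Germ l B) = ((fun x => φ (f x) : ι → C) : Germ l C) := rfl

theorem germMap_mem_germLift_range (φ : B →+ C) (g : Germ l B) :
    germMap l φ g ∈ germLift l φ.range := by
  induction g using Germ.inductionOn with | _ a =>
  exact Eventually.of_forall fun x => ⟨_, rfl⟩

theorem germLift_mono {D D' : AddSubgroup B} (h : D ≤ D') : germLift l D ≤ germLift l D' := by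
  intro g hg
  induction g using Germ.inductionOn with | _ a =>
  exact (coe_mem_germLift.1 hg).mono fun x hx => h hx

end GermLift

/-! ### Slices -/

section Slice

variable {X : Type*} [AddCommGroup X] [TopologicalSpace X] [IsTopologicalAddGroup X]
  [CompactSpace X] [SecondCountableTopology X] [MeasurableSpace X] [BorelSpace X]
  {A : Type*} [AddCommGroup A] [TopologicalSpace A] [IsTopologicalAddGroup A]
  {n m : ℕ}

theorem measurePreserving_cons :
    MeasurePreserving (fun p : X × (Fin n → X) => (Fin.cons p.1 p.2 : Fin (n + 1) → X))
      ((haarProb X).prod (haarProb (Fin n → X))) (haarProb (Fin (n + 1) → X)) := by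
  let φ : X × (Fin n → X) →+ (Fin (n + 1) → X) :=
    AddMonoidHom.mk' (fun p => (Fin.cons p.1 p.2 : Fin (n + 1) → X)) fun p q => by
      funext i
      refine Fin.cases ?_ (fun i => ?_) i <;> simp
  have hc : Continuous φ := by
    refine continuous_pi fun i => ?_
    refine Fin.cases ?_ (fun i => ?_) i
    · exact continuous_fst
    · exact (continuous_apply i).comp continuous_snd
  exact φ.measurePreserving hc (fun x => ⟨(x 0, Fin.tail x), Fin.cons_self_tail x⟩) (by simp)

open Classical in
/-- The slice `f(c, ·)` of a measurable function (with value `0` for the null set of all `c` for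
which this slice is not measurable). -/
def sliceFun (f : MeasFun (Fin (n + 1) → X) A) (c : X) : MeasFun (Fin n → X) A :=
  if h : AEStronglyMeasurable (fun y : Fin n → X => f (Fin.cons c y)) (haarProb (Fin n → X))
  then AEEqFun.mk _ h else 0

theorem coeFn_sliceFun {f : MeasFun (Fin (n + 1) → X) A} {F : (Fin (n + 1) → X) → A}
    (hF : ⇑f =ᵐ[haarProb _] F) :
    ∀ᵐ c ∂haarProb X, ⇑(sliceFun f c) =ᵐ[haarProb _] fun y => F (Fin.cons c y) := by
  have h1 : AEStronglyMeasurable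
      (fun p : X × (Fin n → X) => f (Fin.cons p.1 p.2 : Fin (n + 1) → X))
      ((haarProb X).prod (haarProb (Fin n → X))) :=
    f.aestronglyMeasurable.comp_measurePreserving measurePreserving_cons
  have h2 := Measure.ae_ae_of_ae_prod (measurePreserving_cons.quasiMeasurePreserving.ae hF)
  filter_upwards [h1.prodMk_left, h2] with c hc hc'
  rw [sliceFun, dif_pos hc]
  exact (AEEqFun.coeFn_mk _ _).trans hc'

/-- Representatives of a sum agree with the sum of representatives only off a null set, so
additivity can fail on a null set of `c`. This is why `slice` takes values in germs. -/
theorem sliceFun_add (f g : MeasFun (Fin (n + 1) → X) A) :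
    ∀ᵐ c ∂haarProb X, sliceFun (f + g) c = sliceFun f c + sliceFun g c := by
  filter_upwards [coeFn_sliceFun (AEEqFun.coeFn_add f g), coeFn_sliceFun (ae_eq_refl f),
    coeFn_sliceFun (ae_eq_refl g)] with c h1 h2 h3
  refine AEEqFun.ext (h1.trans ?_)
  filter_upwards [h2, h3, AEEqFun.coeFn_add (sliceFun f c) (sliceFun g c)] with y h2 h3 h4
  rw [h4, Pi.add_apply, Pi.add_apply, h2, h3]

/-- The homomorphism that takes a function `f` on `X^{n+1}` to the germ of `c ↦ f(c, ·)` along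
the almost-everywhere filter. -/
def slice (X A : Type*) [AddCommGroup X] [TopologicalSpace X] [IsTopologicalAddGroup X]
    [CompactSpace X] [SecondCountableTopology X] [MeasurableSpace X] [BorelSpace X]
    [AddCommGroup A] [TopologicalSpace A] [IsTopologicalAddGroup A] (n : ℕ) :
    MeasFun (Fin (n + 1) → X) A →+ Germ (ae (haarProb X)) (MeasFun (Fin n → X) A) :=
  AddMonoidHom.mk' (fun f => (sliceFun f : X → MeasFun (Fin n → X) A)) fun f g =>
    Germ.coe_eq.2 (sliceFun_add f g)

theorem slice_apply (f : MeasFun (Fin (n + 1) → X) A) :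
    slice X A n f = ((sliceFun f : X → MeasFun (Fin n → X) A) : Germ _ _) := rfl

theorem slice_pullback {Φ : (Fin (n + 1) → X) → (Fin (m + 1) → X)} {ψ : (Fin n → X) → (Fin m → X)}
    (hΦ : MeasurePreserving Φ (haarProb _) (haarProb _))
    (hψ : MeasurePreserving ψ (haarProb _) (haarProb _))
    (h : ∀ c y, Φ (Fin.cons c y) = Fin.cons c (ψ y)) (f : MeasFun (Fin (m + 1) → X) A) :
    slice X A n (pullback A Φ hΦ f) = germMap _ (pullback A ψ hψ) (slice X A m f) := by
  rw [slice_apply, slice_apply, germMap_coe]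
  refine Germ.coe_eq.2 ?_
  filter_upwards [coeFn_sliceFun (coeFn_pullback hΦ f), coeFn_sliceFun (ae_eq_refl f)]
    with c h1 h2
  refine AEEqFun.ext (h1.trans ?_)
  refine EventuallyEq.trans ?_ (coeFn_pullback hψ _).symm
  filter_upwards [hψ.quasiMeasurePreserving.ae h2] with y hy
  simp only [Function.comp_apply, h]
  exact hy.symm

theorem slice_pullback_tail {Φ : (Fin (n + 1) → X) → (Fin n → X)}
    (hΦ : MeasurePreserving Φ (haarProb _) (haarProb _))
    (h : ∀ c y, Φ (Fin.cons c y) = y) (f : MeasFun (Fin n → X) A) :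
    slice X A n (pullback A Φ hΦ f) = ((f : MeasFun (Fin n → X) A) : Germ _ _) := by
  rw [slice_apply]
  refine Germ.coe_eq.2 ?_
  filter_upwards [coeFn_sliceFun (coeFn_pullback hΦ f)] with c h1
  refine AEEqFun.ext (h1.trans ?_)
  simp only [Function.comp_apply, h]
  rfl

/-- Fubini for null sets, which needs the zero set of `f` to be measurable. -/
theorem slice_injective [T2Space A] [SecondCountableTopology A]
    {f : MeasFun (Fin (n + 1) → X) A} (hf : ∀ᵐ c ∂haarProb X, sliceFun f c = 0) : f = 0 := by
  have hms : MeasurableSet {x : Fin (n + 1) → X | f x = (0 : A)} :=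
    f.stronglyMeasurable.measurableSet_eq_fun stronglyMeasurable_const
  refine AEEqFun.ext (EventuallyEq.trans ?_ AEEqFun.coeFn_zero.symm)
  change ∀ᵐ x ∂_, f x = 0
  refine ((measurePreserving_cons (X := X) (n := n)).map_eq ▸
    ae_map_iff measurePreserving_cons.measurable.aemeasurable hms :
    (∀ᵐ x ∂haarProb (Fin (n + 1) → X), x ∈ {x : Fin (n + 1) → X | f x = (0 : A)}) ↔ _).2 ?_
  refine (Measure.ae_prod_iff_ae_ae (measurePreserving_cons.measurable hms)).2 ?_
  filter_upwards [hf, coeFn_sliceFun (ae_eq_refl f)] with c h1 h2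
  filter_upwards [h2, (AEEqFun.coeFn_zero : ⇑(0 : MeasFun (Fin n → X) A) =ᵐ[_] 0)] with y h3 h4
  rw [← h3, h1, h4]; rfl

theorem ae_slice {f : MeasFun (Fin (n + 1) → X) A} {D : AddSubgroup (MeasFun (Fin n → X) A)} :
    slice X A n f ∈ germLift _ D ↔ ∀ᵐ c ∂haarProb X, sliceFun f c ∈ D := Iff.rfl

end Slice

/-! ### Homogeneous and inhomogeneous coordinates -/

section Bar

variable {X : Type*} [AddCommGroup X] {n : ℕ}

/-- The map from homogeneous to inhomogeneous coordinates, `g ↦ (g_{i+1} - g_i)_i`. -/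
def bar (n : ℕ) : (Fin (n + 1) → X) →+ (Fin n → X) :=
  AddMonoidHom.mk' (fun g i => g i.succ - g i.castSucc) fun g h => by
    funext i
    simp only [Pi.add_apply]
    abel

theorem bar_apply (g : Fin (n + 1) → X) (i : Fin n) : bar n g i = g i.succ - g i.castSucc := rfl

theorem bar_partialSum (x : Fin n → X) : bar n (Fin.partialSum x) = x := by
  funext i
  rw [bar_apply, Fin.partialSum_succ, add_sub_cancel_left]

theorem bar_const (c : X) : bar n (fun _ => c) = 0 := by
  funext i
  simp [bar_apply]

theorem bar_add_const (g : Fin (n + 1) → X) (c : X) : bar n (fun j => g j + c) = bar n g := by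
  rw [← add_zero (bar n g), ← bar_const c, ← map_add]
  rfl

theorem partialSum_bar (g : Fin (n + 1) → X) (j : Fin (n + 1)) :
    Fin.partialSum (bar n g) j = g j - g 0 := by
  induction j using Fin.induction with
  | zero => simp
  | succ j ih =>
    rw [Fin.partialSum_succ, ih, bar_apply]
    abel

theorem bar_eq_zero {g : Fin (n + 1) → X} (h : bar n g = 0) (j : Fin (n + 1)) : g j = g 0 := by
  have := partialSum_bar g j
  rw [h] at this
  have h0 : ∀ j, Fin.partialSum (0 : Fin n → X) j = 0 := fun j => by
    induction j using Fin.induction with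
    | zero => simp
    | succ j ih => rw [Fin.partialSum_succ, ih]; simp
  rw [h0] at this
  exact (sub_eq_zero.1 this.symm)

theorem partialSum_add (x y : Fin n → X) :
    Fin.partialSum (x + y) = Fin.partialSum x + Fin.partialSum y := by
  funext j
  induction j using Fin.induction with
  | zero => simp
  | succ j ih =>
    rw [Fin.partialSum_succ, ih]
    simp only [Pi.add_apply, Fin.partialSum_succ]
    abel

theorem continuous_partialSum [TopologicalSpace X] [IsTopologicalAddGroup X] :
    Continuous (Fin.partialSum : (Fin n → X) → Fin (n + 1) → X) := by
  refine continuous_pi fun j => ?_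
  induction j using Fin.induction with
  | zero => simpa using continuous_const
  | succ j ih =>
    simp only [Fin.partialSum_succ]
    exact ih.add (continuous_apply j)

theorem continuous_bar [TopologicalSpace X] [IsTopologicalAddGroup X] :
    Continuous (bar n : (Fin (n + 1) → X) → (Fin n → X)) :=
  continuous_pi fun i => (continuous_apply i.succ).sub (continuous_apply i.castSucc)

/-- The two differences on either side of a deleted point add up. Face maps being deletions, the
simplicial identities reduce to identities for `Fin.succAbove`. -/
theorem faceMap_bar (i : Fin (n + 2)) (g : Fin (n + 2) → X) :
    faceMap X n i (bar (n + 1) g) = bar n (g ∘ i.succAbove) := by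
  funext k
  induction i using Fin.cases with
  | zero => rfl
  | succ j =>
    change Fin.contractNth j (· + ·) (bar (n + 1) g) k = _
    rw [bar_apply]
    simp only [Function.comp_apply]
    rcases lt_trichotomy (k : ℕ) j with h | h | h
    · rw [Fin.contractNth_apply_of_lt _ _ _ _ h, bar_apply,
        Fin.succAbove_of_castSucc_lt _ k.succ (by simp [Fin.lt_def]; omega),
        Fin.succAbove_of_castSucc_lt _ k.castSucc (by simp [Fin.lt_def]; omega)]
      rfl
    · rw [Fin.contractNth_apply_of_eq _ _ _ _ h, bar_apply, bar_apply,
        Fin.succAbove_of_le_castSucc _ k.succ (by simp [Fin.le_def]; omega),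
        Fin.succAbove_of_castSucc_lt _ k.castSucc (by simp [Fin.lt_def]; omega)]
      have : k.succ.castSucc = k.castSucc.succ := rfl
      rw [this]
      abel
    · rw [Fin.contractNth_apply_of_gt _ _ _ _ h, bar_apply,
        Fin.succAbove_of_le_castSucc _ k.succ (by simp [Fin.le_def]; omega),
        Fin.succAbove_of_le_castSucc _ k.castSucc (by simp [Fin.le_def]; omega)]
      rfl

theorem faceMap_eq_bar (i : Fin (n + 2)) (x : Fin (n + 1) → X) :
    faceMap X n i x = bar n (Fin.partialSum x ∘ i.succAbove) := by
  rw [← faceMap_bar, bar_partialSum]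

theorem faceMap_faceMap (k : Fin (n + 3)) (i : Fin (n + 2)) (x : Fin (n + 2) → X) :
    faceMap X n i (faceMap X (n + 1) k x) =
      faceMap X n (i.predAbove k) (faceMap X (n + 1) (k.succAbove i) x) := by
  rw [faceMap_eq_bar k, faceMap_eq_bar (k.succAbove i), faceMap_bar, faceMap_bar]
  congr 1
  funext j
  simp only [Function.comp_apply, Fin.succAbove_succAbove_succAbove_predAbove]

/-- The map `X^{n+1} → X^{n+1}` that inserts a new homogeneous coordinate at position `k`, at
distance `w_0` from the coordinate at position `b` of the remaining ones, whose inhomogeneous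
coordinates are `w_1, …, w_n`. -/
def insertMap (k : Fin (n + 2)) (b : Fin (n + 1)) : (Fin (n + 1) → X) →+ (Fin (n + 1) → X) :=
  AddMonoidHom.mk' (fun w => bar (n + 1)
    (k.insertNth (Fin.partialSum (Fin.tail w) b + w 0) (Fin.partialSum (Fin.tail w)) :
      Fin (n + 2) → X)) fun v w => by
    rw [← map_add]
    congr 1
    have ht : Fin.tail (v + w) = Fin.tail v + Fin.tail w := rfl
    rw [ht, partialSum_add]
    funext j
    rcases Fin.eq_self_or_eq_succAbove k j with rfl | ⟨j, rfl⟩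
    · simp only [Fin.insertNth_apply_same, Pi.add_apply]
      abel
    · simp only [Fin.insertNth_apply_succAbove, Pi.add_apply]

theorem insertMap_cons (k : Fin (n + 2)) (b : Fin (n + 1)) (c : X) (x : Fin n → X) :
    insertMap k b (Fin.cons c x) = bar (n + 1)
      (k.insertNth (Fin.partialSum x b + c) (Fin.partialSum x) : Fin (n + 2) → X) := rfl

theorem insertMap_cons_bar (k : Fin (n + 2)) (b : Fin (n + 1)) (c : X) (g : Fin (n + 1) → X) :
    insertMap k b (Fin.cons c (bar n g)) = bar (n + 1)
      (k.insertNth (g b + c) g : Fin (n + 2) → X) := by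
  rw [insertMap_cons, ← bar_add_const _ (g 0)]
  congr 1
  funext j
  rcases Fin.eq_self_or_eq_succAbove k j with rfl | ⟨j, rfl⟩
  · simp only [Fin.insertNth_apply_same, partialSum_bar]
    abel
  · simp only [Fin.insertNth_apply_succAbove, partialSum_bar]
    abel

theorem insertMap_surjective (k : Fin (n + 2)) (b : Fin (n + 1)) :
    Function.Surjective (insertMap k b : (Fin (n + 1) → X) →+ (Fin (n + 1) → X)) := fun x => by
  -- The preimage deletes the point at position `k` and records its distance from the base point.
  refine ⟨Fin.cons (Fin.partialSum x k - Fin.partialSum x (k.succAbove b))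
    (bar n (Fin.partialSum x ∘ k.succAbove)), ?_⟩
  rw [insertMap_cons_bar]
  conv_rhs => rw [← bar_partialSum x]
  congr 1
  funext j
  rcases Fin.eq_self_or_eq_succAbove k j with rfl | ⟨j, rfl⟩
  · simp
  · simp

theorem continuous_insertMap [TopologicalSpace X] [IsTopologicalAddGroup X] (k : Fin (n + 2))
    (b : Fin (n + 1)) : Continuous (insertMap k b : (Fin (n + 1) → X) →+ (Fin (n + 1) → X)) := by
  have ht : Continuous (fun w : Fin (n + 1) → X => Fin.partialSum (Fin.tail w)) :=
    continuous_partialSum.comp (continuous_pi fun i => continuous_apply i.succ)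
  refine continuous_bar.comp (continuous_pi fun j => ?_)
  rcases Fin.eq_self_or_eq_succAbove k j with rfl | ⟨j, rfl⟩
  · simp only [Fin.insertNth_apply_same]
    exact ((continuous_apply b).comp ht).add (continuous_apply 0)
  · simp only [Fin.insertNth_apply_succAbove]
    exact (continuous_apply j).comp ht

theorem faceMap_insertMap_same (k : Fin (n + 2)) (b : Fin (n + 1)) (c : X) (x : Fin n → X) :
    faceMap X n k (insertMap k b (Fin.cons c x)) = x := by
  rw [insertMap_cons, faceMap_bar]
  conv_rhs => rw [← bar_partialSum x]
  congr 1
  funext j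
  simp

/-- Inserting a point commutes with deleting a different one, provided the base point survives the
deletion. Writing the base as `i.succAbove b` ensures this. -/
theorem faceMap_insertMap (k : Fin (n + 3)) (i : Fin (n + 2)) (b : Fin (n + 1)) (c : X)
    (x : Fin (n + 1) → X) :
    faceMap X (n + 1) (k.succAbove i) (insertMap k (i.succAbove b) (Fin.cons c x)) =
      insertMap (i.predAbove k) b (Fin.cons c (faceMap X n i x)) := by
  rw [insertMap_cons, faceMap_bar, faceMap_eq_bar, insertMap_cons_bar]
  congr 1
  funext j
  rcases Fin.eq_self_or_eq_succAbove (i.predAbove k) j with rfl | ⟨j, rfl⟩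
  · simp only [Function.comp_apply, Fin.insertNth_apply_same, Fin.succAbove_succAbove_predAbove]
  · simp only [Function.comp_apply, Fin.insertNth_apply_succAbove,
      Fin.succAbove_succAbove_succAbove_predAbove]

end Bar

/-! ### Coface maps and partial evaluation -/

section Coface

variable (X : Type*) [AddCommGroup X] [TopologicalSpace X] [IsTopologicalAddGroup X]
  [CompactSpace X] [SecondCountableTopology X] [MeasurableSpace X] [BorelSpace X]
  (A : Type*) [AddCommGroup A] [TopologicalSpace A] [IsTopologicalAddGroup A]

/-- The coface maps of the cosimplicial group of measurable cochains. -/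
def coface (n : ℕ) (i : Fin (n + 2)) : Cochain X A n →+ Cochain X A (n + 1) :=
  pullback A (faceMap X n i) (faceMap_measurePreserving X n i)

theorem cobdry_apply (n : ℕ) (f : Cochain X A n) :
    cobdry X A n f = ∑ j : Fin (n + 2), (-1 : ℤ) ^ (j : ℕ) • coface X A n j f := by
  simp [cobdry, coface]

variable {X A} {n : ℕ}

theorem coface_coface (k : Fin (n + 3)) (i : Fin (n + 2)) (h : Cochain X A n) :
    coface X A (n + 1) k (coface X A n i h) =
      coface X A (n + 1) (k.succAbove i) (coface X A n (i.predAbove k) h) := by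
  unfold coface
  rw [pullback_pullback, pullback_pullback]
  exact pullback_congr (funext fun x => faceMap_faceMap k i x) _ _ _

theorem coface_coface_of_lt (k : Fin (n + 2)) (i : Fin (n + 2)) (hik : i ≤ k)
    (h : Cochain X A n) :
    coface X A (n + 1) k.succ (coface X A n i h) =
      coface X A (n + 1) i.castSucc (coface X A n k h) := by
  rw [coface_coface, Fin.succAbove_of_castSucc_lt _ _ (Fin.castSucc_lt_succ_iff.2 hik),
    Fin.predAbove_of_castSucc_lt _ _ (Fin.castSucc_lt_succ_iff.2 hik), Fin.pred_succ]

theorem measurePreserving_insertMap (k : Fin (n + 2)) (b : Fin (n + 1)) :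
    MeasurePreserving (insertMap k b : (Fin (n + 1) → X) →+ (Fin (n + 1) → X))
      (haarProb _) (haarProb _) :=
  measurePreserving_of_surjective _ (continuous_insertMap k b) (insertMap_surjective k b)

variable (X A) in
/-- Partial evaluation: the germ in `c` of the cochain obtained by giving the homogeneous
coordinate at position `k` the distance `c` from the one at position `b` of the others. -/
def evalAt (k : Fin (n + 2)) (b : Fin (n + 1)) :
    Cochain X A (n + 1) →+ Germ (ae (haarProb X)) (Cochain X A n) :=
  (slice X A n).comp (pullback A (insertMap k b) (measurePreserving_insertMap k b))

theorem evalAt_coface_same (k : Fin (n + 2)) (b : Fin (n + 1)) (h : Cochain X A n) :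
    evalAt X A k b (coface X A n k h) = ((h : Cochain X A n) : Germ _ _) := by
  change slice X A n (pullback A _ _ (pullback A _ _ h)) = _
  rw [pullback_pullback]
  exact slice_pullback_tail _ (faceMap_insertMap_same k b) h

theorem measurePreserving_cons_faceMap (i : Fin (n + 2)) :
    MeasurePreserving (fun w : Fin (n + 2) → X =>
      (Fin.cons (w 0) (faceMap X n i (Fin.tail w)) : Fin (n + 1) → X))
      (haarProb _) (haarProb _) := by
  refine measurePreserving_of_surjective (AddMonoidHom.mk' (fun w : Fin (n + 2) → X =>
      (Fin.cons (w 0) (faceMap X n i (Fin.tail w)) : Fin (n + 1) → X)) fun v w => ?_) ?_ ?_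
  · have ht : Fin.tail (v + w) = Fin.tail v + Fin.tail w := rfl
    rw [ht, faceMap_add]
    funext j
    induction j using Fin.cases <;> rfl
  · refine continuous_pi fun j => ?_
    induction j using Fin.cases with
    | zero => exact continuous_apply 0
    | succ j =>
      exact (continuous_apply j).comp ((faceMap_continuous X n i).comp
        (continuous_pi fun i => continuous_apply i.succ))
  · intro y
    obtain ⟨z, hz⟩ := faceMap_surjective X n i (Fin.tail y)
    refine ⟨Fin.cons (y 0) z, ?_⟩
    change (Fin.cons _ (faceMap X n i z) : Fin (n + 1) → X) = y
    rw [hz]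
    exact Fin.cons_self_tail y

theorem evalAt_coface (k : Fin (n + 3)) (i : Fin (n + 2)) (b : Fin (n + 1))
    (h : Cochain X A (n + 1)) :
    evalAt X A k (i.succAbove b) (coface X A (n + 1) (k.succAbove i) h) =
      germMap _ (coface X A n i) (evalAt X A (i.predAbove k) b h) := by
  change slice X A (n + 1) (pullback A _ _ (pullback A _ _ h)) =
    germMap _ _ (slice X A n (pullback A _ _ h))
  unfold coface
  rw [← slice_pullback (measurePreserving_cons_faceMap i) _ (fun c y => rfl), pullback_pullback,
    pullback_pullback]
  congr 1
  refine pullback_congr (funext fun w => ?_) _ _ _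
  rw [← Fin.cons_self_tail w]
  exact faceMap_insertMap k i b _ _

end Coface

/-! ### Acyclicity of the complex of sums of coface images -/

section Acyclic

variable (X : Type*) [AddCommGroup X] [TopologicalSpace X] [IsTopologicalAddGroup X]
  [CompactSpace X] [SecondCountableTopology X] [MeasurableSpace X] [BorelSpace X]
  (A : Type*) [AddCommGroup A] [TopologicalSpace A] [IsTopologicalAddGroup A]

/-- The sums of cochains in the images of the coface maps with index below `j`. -/
def lowFaces (n j : ℕ) : AddSubgroup (Cochain X A (n + 1)) :=
  ⨆ i : {i : Fin (n + 2) // (i : ℕ) < j}, (coface X A n i.1).range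

/-- The part of the differential that involves the coface maps with index above `j`. -/
def highCobdry (n j : ℕ) : Cochain X A n →+ Cochain X A (n + 1) :=
  ∑ i : Fin (n + 2), if j < (i : ℕ) then (-1 : ℤ) ^ (i : ℕ) • coface X A n i else 0

variable {X A} {n j : ℕ}

theorem coface_mem_lowFaces {i : Fin (n + 2)} (hi : (i : ℕ) < j) (h : Cochain X A n) :
    coface X A n i h ∈ lowFaces X A n j :=
  AddSubgroup.mem_iSup_of_mem ⟨i, hi⟩ ⟨h, rfl⟩

theorem lowFaces_le {D : AddSubgroup (Cochain X A (n + 1))}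
    (hD : ∀ i : Fin (n + 2), (i : ℕ) < j → ∀ h, coface X A n i h ∈ D) :
    lowFaces X A n j ≤ D :=
  iSup_le fun i => by
    rintro _ ⟨h, rfl⟩
    exact hD i.1 i.2 h

theorem lowFaces_mono {k : ℕ} (hjk : j ≤ k) : lowFaces X A n j ≤ lowFaces X A n k :=
  lowFaces_le fun _ hi h => coface_mem_lowFaces (hi.trans_le hjk) h

theorem exists_of_mem_lowFaces_succ (j : Fin (n + 2)) {x : Cochain X A (n + 1)}
    (hx : x ∈ lowFaces X A n (j + 1)) :
    ∃ h : Cochain X A n, ∃ y ∈ lowFaces X A n j, x = coface X A n j h + y := by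
  have hle : lowFaces X A n (j + 1) ≤ (coface X A n j).range ⊔ lowFaces X A n j := by
    refine lowFaces_le fun i hi h => ?_
    rcases Nat.lt_succ_iff_lt_or_eq.1 hi with hi | hi
    · exact AddSubgroup.mem_sup_right (coface_mem_lowFaces hi h)
    · rw [Fin.ext hi]
      exact AddSubgroup.mem_sup_left ⟨h, rfl⟩
  obtain ⟨_, ⟨h, rfl⟩, y, hy, rfl⟩ := AddSubgroup.mem_sup.1 (hle hx)
  exact ⟨h, y, hy, rfl⟩

/-- For `i < j ≤ k`, `δ^k δ^i = δ^i δ^{k-1}`, so the outer coface can again be taken of index `i`.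
-/
theorem coface_mem_of_mem_lowFaces {k : Fin (n + 3)} {x : Cochain X A (n + 1)}
    (hk : j ≤ (k : ℕ)) (hx : x ∈ lowFaces X A n j) :
    coface X A (n + 1) k x ∈ lowFaces X A (n + 1) j := by
  have hle : lowFaces X A n j ≤ (lowFaces X A (n + 1) j).comap (coface X A (n + 1) k) := by
    refine lowFaces_le fun i hi h => ?_
    obtain ⟨k, rfl⟩ : ∃ k' : Fin (n + 2), k = k'.succ :=
      ⟨k.pred (by rintro rfl; simp at hk; omega), by simp⟩
    change coface X A (n + 1) k.succ (coface X A n i h) ∈ lowFaces X A (n + 1) j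
    have hik : i ≤ k := by
      rw [Fin.val_succ] at hk
      rw [Fin.le_def]
      omega
    have hc := coface_coface_of_lt k i hik h
    exact hc ▸ coface_mem_lowFaces (i := i.castSucc) hi _
  exact hle hx

theorem cobdry_mem_lowFaces {x : Cochain X A (n + 1)} (hx : x ∈ lowFaces X A n j) :
    cobdry X A (n + 1) x ∈ lowFaces X A (n + 1) j := by
  rw [cobdry_apply]
  refine sum_mem fun k _ => zsmul_mem ?_ _
  rcases lt_or_ge (k : ℕ) j with hk | hk
  · exact coface_mem_lowFaces hk _
  · exact coface_mem_of_mem_lowFaces hk hx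

theorem cobdry_cobdry (x : Cochain X A n) : cobdry X A (n + 1) (cobdry X A n x) = 0 := by
  simp only [cobdry_apply, map_sum, map_zsmul, Finset.smul_sum, smul_smul]
  rw [Finset.sum_comm, ← Finset.sum_product']
  -- The involution exchanges the two ways of deleting the same pair of points; they carry opposite
  -- signs.
  refine Finset.sum_involution (fun p _ => (p.1.succAbove p.2, p.2.predAbove p.1)) ?_ ?_ ?_ ?_
  · rintro ⟨k, i⟩ -
    dsimp only
    rw [← coface_coface k i, ← add_smul]
    rcases lt_or_ge i.castSucc k with h | h
    · obtain ⟨k, rfl⟩ : ∃ k', k = Fin.succ k' := ⟨k.pred (Fin.ne_zero_of_lt h), by simp⟩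
      rw [Fin.succAbove_of_castSucc_lt _ _ h, Fin.predAbove_of_castSucc_lt _ _ h, Fin.pred_succ]
      simp only [Fin.val_succ, Fin.val_castSucc]
      convert zero_smul ℤ _ using 2
      ring
    · obtain ⟨k, rfl⟩ : ∃ k', k = Fin.castSucc k' :=
        ⟨k.castPred (Fin.ne_last_of_lt (h.trans_lt i.castSucc_lt_succ)), by simp⟩
      rw [Fin.succAbove_of_le_castSucc _ _ h, Fin.predAbove_of_le_castSucc _ _ h,
        Fin.castPred_castSucc]
      simp only [Fin.val_succ, Fin.val_castSucc]
      convert zero_smul ℤ _ using 2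
      ring
  · rintro ⟨k, i⟩ - - h
    exact Fin.succAbove_ne k i (congrArg Prod.fst h)
  · intros
    exact Finset.mem_product.2 ⟨Finset.mem_univ _, Finset.mem_univ _⟩
  · rintro ⟨k, i⟩ -
    dsimp only
    rw [Fin.succAbove_succAbove_predAbove, Fin.predAbove_predAbove_succAbove]

theorem highCobdry_apply (h : Cochain X A n) : highCobdry X A n j h =
    ∑ i : Fin (n + 2), if j < (i : ℕ) then (-1 : ℤ) ^ (i : ℕ) • coface X A n i h else 0 := by
  rw [highCobdry, AddMonoidHom.finsetSum_apply]
  refine Finset.sum_congr rfl fun i _ => ?_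
  split_ifs <;> rfl

theorem highCobdry_eq_zero (hj : n < j) (h : Cochain X A n) : highCobdry X A n j h = 0 := by
  rw [highCobdry_apply]
  exact Finset.sum_eq_zero fun i _ => if_neg (by omega)

/-- In the coboundary of `δ^j h`, the terms `δ^k δ^j h` with `k < j` are low, those with `k = j` and
`k = j + 1` cancel, and for `k > j + 1` the identity `δ^k δ^j = δ^j δ^{k-1}` shifts the index and so
flips the sign. -/
theorem cobdry_coface_add (j : Fin (n + 2)) (h : Cochain X A n) :
    cobdry X A (n + 1) (coface X A n j h) + coface X A (n + 1) j.castSucc (highCobdry X A n j h)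
      ∈ lowFaces X A (n + 1) j := by
  rw [cobdry_apply, Fin.sum_univ_succAbove _ j.castSucc, highCobdry_apply, map_sum,
    add_assoc (_ • _), ← Finset.sum_add_distrib]
  set P := coface X A (n + 1) j.castSucc (coface X A n j h) with hP
  have h1 : (-1 : ℤ) ^ (j.castSucc : ℕ) • P =
      ∑ i : Fin (n + 2), if i = j then (-1 : ℤ) ^ (j : ℕ) • P else 0 := by simp
  rw [h1, ← Finset.sum_add_distrib]
  refine sum_mem fun i _ => ?_
  rcases lt_trichotomy i j with hij | hij | hij
  · rw [if_neg hij.ne, if_neg (by exact fun h => absurd hij (by rw [Fin.lt_def]; omega)), map_zero,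
      zero_add, add_zero, Fin.succAbove_of_castSucc_lt _ _ (Fin.castSucc_lt_castSucc_iff.2 hij)]
    exact zsmul_mem (coface_mem_lowFaces (i := i.castSucc) (by exact hij) _) _
  · subst hij
    rw [if_pos rfl, if_neg (lt_irrefl _), map_zero, add_zero, Fin.succAbove_castSucc_self,
      coface_coface_of_lt i i le_rfl h, ← hP, Fin.val_succ, pow_succ, mul_neg_one, neg_smul,
      add_neg_cancel]
    exact zero_mem _
  · rw [if_neg hij.ne', if_pos (by exact hij), zero_add,
      Fin.succAbove_of_le_castSucc _ _ (Fin.castSucc_le_castSucc_iff.2 hij.le),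
      coface_coface_of_lt i j hij.le h, map_zsmul, Fin.val_succ, pow_succ, mul_neg_one, neg_smul,
      neg_add_cancel]
    exact zero_mem _

/-- A coface of index `i < j` deletes a point below both the inserted one and its base, so it passes
through the evaluation with its index unchanged. -/
theorem evalAt_mem_germLift {k : Fin (n + 3)} {b : Fin (n + 2)} (hk : j ≤ (k : ℕ))
    (hb : j ≤ (b : ℕ)) {x : Cochain X A (n + 2)} (hx : x ∈ lowFaces X A (n + 1) j) :
    evalAt X A k b x ∈ germLift _ (lowFaces X A n j) := by
  have hle : lowFaces X A (n + 1) j ≤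
      (germLift _ (lowFaces X A n j)).comap (evalAt X A k b) := by
    refine lowFaces_le fun i hi h => ?_
    have hik : i < k := by rw [Fin.lt_def]; omega
    obtain ⟨i, rfl⟩ : ∃ i', i = Fin.castSucc i' := ⟨i.castPred (Fin.ne_last_of_lt hik), by simp⟩
    rw [Fin.val_castSucc] at hi
    obtain ⟨b, rfl⟩ := Fin.exists_succAbove_eq (x := b) (y := i) (by rintro rfl; omega)
    rw [AddSubgroup.mem_comap, ← Fin.succAbove_of_castSucc_lt k i hik, evalAt_coface]
    refine germLift_mono ?_ (germMap_mem_germLift_range _ _)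
    rintro _ ⟨y, rfl⟩
    exact coface_mem_lowFaces hi y
  exact hle hx

/-- Evaluating coordinate `k` recovers `x` as a constant germ and preserves low sums. The base is
the point following position `k`, which exists because `k` is not last. -/
theorem mem_lowFaces_of_coface_mem {k : Fin (n + 3)} (hk : k ≠ Fin.last _)
    {x : Cochain X A (n + 1)} (hx : coface X A (n + 1) k x ∈ lowFaces X A (n + 1) k) :
    x ∈ lowFaces X A n k := by
  have := evalAt_mem_germLift (b := k.castPred hk) le_rfl (by simp) hx
  rw [evalAt_coface_same] at this
  exact const_mem_germLift.1 this

theorem germMap_highCobdry {ι : Type*} {l : Filter ι} (g : Germ l (Cochain X A n)) :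
    germMap l (highCobdry X A n j) g = ∑ i : Fin (n + 2),
      if j < (i : ℕ) then (-1 : ℤ) ^ (i : ℕ) • germMap l (coface X A n i) g else 0 := by
  let ev : (Cochain X A n →+ Cochain X A (n + 1)) →+ Germ l (Cochain X A (n + 1)) :=
    AddMonoidHom.mk' (fun φ => germMap l φ g) fun φ ψ => by
      induction g using Germ.inductionOn with | _ g => rfl
  have hev : ∀ φ, ev φ = germMap l φ g := fun _ => rfl
  rw [← hev, highCobdry, map_sum]
  refine Finset.sum_congr rfl fun i _ => ?_
  split_ifs
  · rw [map_zsmul, hev]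
  · exact map_zero ev

/-- Exactness of the truncated differential modulo low faces, by a contraction: evaluating the point
at position `j + 1` relative to the one at `j` turns the term of index `j + 1` into `± h` and every
later `δ^{i+1} h` into `δ^i` of the evaluation of `h`. -/
theorem exists_sub_highCobdry_mem (j : Fin (n + 2)) {h : Cochain X A (n + 1)}
    (hh : highCobdry X A (n + 1) j h ∈ lowFaces X A (n + 1) j) :
    ∃ h' : Cochain X A n,
      h - (-1 : ℤ) ^ ((j : ℕ) + 1) • highCobdry X A n j h' ∈ lowFaces X A n j := by
  have hmem := evalAt_mem_germLift (k := j.succ) (b := j) (by simp) le_rfl hh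
  have hsplit : evalAt X A j.succ j (highCobdry X A (n + 1) j h) =
      (-1 : ℤ) ^ ((j : ℕ) + 1) • ((h : Cochain X A (n + 1)) : Germ (ae (haarProb X)) _) +
      ∑ i : Fin (n + 2), if (j : ℕ) < i then (-1 : ℤ) ^ ((i : ℕ) + 1) •
        evalAt X A j.succ j (coface X A (n + 1) i.succ h) else 0 := by
    rw [highCobdry_apply, map_sum, Fin.sum_univ_succAbove _ j.succ, if_pos (by simp), map_zsmul,
      evalAt_coface_same, Fin.val_succ]
    congr 1
    refine Finset.sum_congr rfl fun i _ => ?_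
    rcases lt_or_ge j i with hij | hij
    · rw [Fin.succAbove_of_le_castSucc _ _ (by rw [Fin.le_def]; exact hij),
        if_pos (by rw [Fin.val_succ, Nat.lt_succ_iff]; exact hij.le), if_pos (by exact hij),
        map_zsmul, Fin.val_succ]
    · rw [Fin.succAbove_of_castSucc_lt _ _ (Fin.castSucc_lt_succ_iff.2 hij),
        if_neg (not_lt_of_ge (by exact hij)), if_neg (not_lt_of_ge (by exact hij)), map_zero]
  have hone : (-1 : ℤ) ^ ((j : ℕ) + 1) * (-1 : ℤ) ^ ((j : ℕ) + 1) = 1 := by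
    rw [← mul_pow]; simp
  -- For the last `j` only the coface of index `j + 1` is high, so `h` itself is low and no
  -- correction is needed.
  rcases eq_or_ne j (Fin.last _) with hj | hj
  · refine ⟨0, ?_⟩
    rw [map_zero, smul_zero, sub_zero]
    rw [hsplit, Finset.sum_eq_zero (fun i _ => if_neg (by subst hj; have := i.2; simp; omega)),
      add_zero, ← Germ.const_smul, const_mem_germLift] at hmem
    have := zsmul_mem hmem ((-1 : ℤ) ^ ((j : ℕ) + 1))
    rwa [smul_smul, hone, one_smul] at this
  · obtain ⟨j, rfl⟩ : ∃ j' : Fin (n + 1), j = j'.castSucc := ⟨j.castPred hj, by simp⟩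
    have hT : ∀ i : Fin (n + 2), (j.castSucc : ℕ) < i →
        evalAt X A j.castSucc.succ j.castSucc (coface X A (n + 1) i.succ h) =
          germMap _ (coface X A n i) (evalAt X A j.succ j h) := fun i hi => by
      have h1 : i.succAbove j = j.castSucc := Fin.succAbove_of_castSucc_lt _ _ hi
      have h2 : j.castSucc.succ.succAbove i = i.succ :=
        Fin.succAbove_of_le_castSucc _ _ (by rw [Fin.le_def]; exact hi)
      have h3 : i.predAbove j.castSucc.succ = j.succ :=
        (Fin.predAbove_of_le_castSucc _ _ (by rw [Fin.le_def]; exact hi)).trans (by ext; simp)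
      have := evalAt_coface j.castSucc.succ i j h
      rwa [h1, h2, h3] at this
    have hsum : (∑ i : Fin (n + 2), if (j.castSucc : ℕ) < i then (-1 : ℤ) ^ ((i : ℕ) + 1) •
        evalAt X A j.castSucc.succ j.castSucc (coface X A (n + 1) i.succ h) else 0) =
        - germMap _ (highCobdry X A n j) (evalAt X A j.succ j h) := by
      rw [germMap_highCobdry, ← Finset.sum_neg_distrib]
      refine Finset.sum_congr rfl fun i _ => ?_
      by_cases hi : (j.castSucc : ℕ) < i
      · rw [if_pos hi, if_pos (by exact hi), hT i hi, pow_succ, mul_neg_one, neg_smul]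
      · rw [if_neg hi, if_neg (by exact hi), neg_zero]
    rw [hsplit, hsum] at hmem
    revert hmem
    induction evalAt X A j.succ j h using Germ.inductionOn with | _ g =>
    intro hmem
    rw [germMap_coe, ← sub_eq_add_neg, ← Germ.const_smul] at hmem
    -- Any `c` outside the null set gives an honest cochain `h'`.
    obtain ⟨c, hc⟩ := (coe_mem_germLift.1 hmem : ∀ᶠ c in ae (haarProb X), _).exists
    refine ⟨g c, ?_⟩
    have := zsmul_mem hc ((-1 : ℤ) ^ ((j.castSucc : ℕ) + 1))
    change _ • ((-1 : ℤ) ^ ((j.castSucc : ℕ) + 1) • h - highCobdry X A n j (g c)) ∈ _ at this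
    rwa [smul_sub, smul_smul, hone, one_smul] at this

/-- Write `x = δ^j h + x'` with `x'` of index below `j`. Closedness makes the truncated differential
of `h` low, so `h` is, modulo low terms, `±` the truncated differential of some `h'`. Adding `±` the
coboundary of `δ^j h'` then removes `δ^j h` from `x` modulo lower indices, and induction applies. -/
theorem exists_cobdry_eq {x : Cochain X A (n + 2)} (hj : j ≤ n + 2)
    (hx : x ∈ lowFaces X A (n + 1) j) (hd : cobdry X A (n + 2) x = 0) :
    ∃ y ∈ lowFaces X A n (n + 1), cobdry X A (n + 1) y = x := by
  induction j generalizing x with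
  | zero =>
    have : lowFaces X A (n + 1) 0 ≤ ⊥ := lowFaces_le fun i hi => absurd hi (Nat.not_lt_zero _)
    exact ⟨0, zero_mem _, by rw [map_zero, AddSubgroup.mem_bot.1 (this hx)]⟩
  | succ j ih =>
    let J : Fin (n + 2) := ⟨j, hj⟩
    obtain ⟨h, x', hx', rfl⟩ := exists_of_mem_lowFaces_succ J.castSucc hx
    have hx' : x' ∈ lowFaces X A (n + 1) J := hx'
    have hT : highCobdry X A (n + 1) J h ∈ lowFaces X A (n + 1) J := by
      refine mem_lowFaces_of_coface_mem (k := J.castSucc.castSucc) (Fin.castSucc_ne_last _) ?_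
      have h1 := add_mem (cobdry_coface_add J.castSucc h) (cobdry_mem_lowFaces hx')
      have h2 : cobdry X A (n + 2) (coface X A (n + 1) J.castSucc h) +
          coface X A (n + 2) J.castSucc.castSucc (highCobdry X A (n + 1) J.castSucc h) +
          cobdry X A (n + 2) x' =
          coface X A (n + 2) J.castSucc.castSucc (highCobdry X A (n + 1) J h) := by
        rw [map_add] at hd
        exact (add_right_comm _ _ _).trans ((congrArg (· + _) hd).trans (zero_add _))
      rw [← h2]
      exact h1
    obtain ⟨h', hh'⟩ := exists_sub_highCobdry_mem J hT
    set s : ℤ := (-1 : ℤ) ^ ((J : ℕ) + 1)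
    have h3 := coface_mem_of_mem_lowFaces (k := J.castSucc) (by simp) hh'
    have h4 := zsmul_mem (cobdry_coface_add J h') s
    have h5 : coface X A (n + 1) J.castSucc h + x' + s • cobdry X A (n + 1) (coface X A n J h') ∈
        lowFaces X A (n + 1) J := by
      have := add_mem (add_mem hx' h3) h4
      rw [map_sub, map_zsmul, smul_add] at this
      convert this using 1
      abel
    rcases Nat.lt_succ_iff_lt_or_eq.1 (show j < n + 2 from hj) with hjn | hjn
    · obtain ⟨y, hy, hyx⟩ := ih (by omega) h5 (by
        rw [map_add, hd, map_zsmul, cobdry_cobdry, smul_zero, zero_add])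
      refine ⟨y - s • coface X A n J h', sub_mem hy (zsmul_mem (coface_mem_lowFaces hjn h') _), ?_⟩
      rw [map_sub, hyx, map_zsmul, add_sub_cancel_right]
    -- For `j = n + 1` the correction `δ^j h'` would use the forbidden last coface. But no coface
    -- lies above `j` in this degree, so `h` is already low and `x` needs no correction.
    · rw [highCobdry_eq_zero (show n < j by omega), smul_zero, sub_zero] at hh'
      exact ih (by omega) (add_mem (coface_mem_of_mem_lowFaces (k := J.castSucc) le_rfl hh')
        hx') hd

end Acyclic

/-! ### Functions killed by iterated differences in coordinate directions -/

section Drop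

variable {X : Type*} [AddCommGroup X] {n : ℕ}

/-- The map that forgets the coordinate at position `i`. -/
def dropHom (X : Type*) [AddCommGroup X] (n : ℕ) (i : Fin (n + 1)) :
    (Fin (n + 1) → X) →+ (Fin n → X) :=
  AddMonoidHom.mk' (fun w j => w (i.succAbove j)) fun _ _ => rfl

theorem dropHom_apply (i : Fin (n + 1)) (w : Fin (n + 1) → X) (j : Fin n) :
    dropHom X n i w j = w (i.succAbove j) := rfl

theorem dropHom_surjective (i : Fin (n + 1)) : Function.Surjective (dropHom X n i) :=
  fun y => ⟨i.insertNth 0 y, by funext j; simp [dropHom_apply]⟩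

theorem dropHom_eq_zero {i : Fin (n + 1)} {w : Fin (n + 1) → X} (h : dropHom X n i w = 0) :
    w = Pi.single i (w i) := by
  funext k
  rcases Fin.eq_self_or_eq_succAbove i k with rfl | ⟨j, rfl⟩
  · simp
  · rw [Pi.single_eq_of_ne (Fin.succAbove_ne i j)]
    exact congrFun h j

theorem dropHom_single (i : Fin (n + 1)) (x : X) : dropHom X n i (Pi.single i x) = 0 := by
  funext j
  rw [dropHom_apply, Pi.single_eq_of_ne (Fin.succAbove_ne i j)]
  rfl

theorem dropHom_succ_cons (i : Fin (n + 1)) (c : X) (y : Fin (n + 1) → X) :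
    dropHom X (n + 1) i.succ (Fin.cons c y) = Fin.cons c (dropHom X n i y) := by
  funext j
  induction j using Fin.cases with
  | zero => simp [dropHom_apply]
  | succ j => simp [dropHom_apply, Fin.succ_succAbove_succ]

end Drop

/-! ### Vanishing mixed differences and sums of functions of fewer variables. -/

section Coordinate

variable {X : Type*} [AddCommGroup X] [TopologicalSpace X] [IsTopologicalAddGroup X]
  [CompactSpace X] [SecondCountableTopology X] [MeasurableSpace X] [BorelSpace X]
  {A : Type*} [AddCommGroup A] [TopologicalSpace A] [IsTopologicalAddGroup A]
  {n : ℕ}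

theorem continuous_dropHom (i : Fin (n + 1)) : Continuous (dropHom X n i) :=
  continuous_pi fun j => continuous_apply (i.succAbove j)

theorem measurePreserving_dropHom (i : Fin (n + 1)) :
    MeasurePreserving (dropHom X n i) (haarProb _) (haarProb _) :=
  measurePreserving_of_surjective _ (continuous_dropHom i) (dropHom_surjective i)

variable (X A) in
/-- Sums of functions each of which does not depend on some coordinate in the set `S`. -/
def coordSum (n : ℕ) (S : Set (Fin (n + 1))) : AddSubgroup (MeasFun (Fin (n + 1) → X) A) :=
  ⨆ i : S, (pullback A (dropHom X n i.1) (measurePreserving_dropHom i.1)).range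

theorem pullback_dropHom_mem {S : Set (Fin (n + 1))} {i : Fin (n + 1)} (hi : i ∈ S)
    (h : MeasFun (Fin n → X) A) :
    pullback A (dropHom X n i) (measurePreserving_dropHom i) h ∈ coordSum X A n S :=
  AddSubgroup.mem_iSup_of_mem (⟨i, hi⟩ : S) ⟨h, rfl⟩

theorem coordSum_le {S : Set (Fin (n + 1))} {D : AddSubgroup (MeasFun (Fin (n + 1) → X) A)}
    (hD : ∀ i ∈ S, ∀ h, pullback A (dropHom X n i) (measurePreserving_dropHom i) h ∈ D) :
    coordSum X A n S ≤ D :=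
  iSup_le fun i => by
    rintro _ ⟨h, rfl⟩
    exact hD i.1 i.2 h

theorem coordSum_mono {S T : Set (Fin (n + 1))} (h : S ⊆ T) :
    coordSum X A n S ≤ coordSum X A n T :=
  coordSum_le fun _ hi _ => pullback_dropHom_mem (h hi) _

theorem slice_mem_coordSum {S : Set (Fin (n + 1))} {f : MeasFun (Fin (n + 2) → X) A}
    (hf : f ∈ coordSum X A (n + 1) (Fin.succ '' S)) :
    slice X A (n + 1) f ∈ germLift _ (coordSum X A n S) := by
  have hle : coordSum X A (n + 1) (Fin.succ '' S) ≤
      (germLift _ (coordSum X A n S)).comap (slice X A (n + 1)) := by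
    refine coordSum_le ?_
    rintro _ ⟨i, hi, rfl⟩ h
    have h1 := slice_pullback (measurePreserving_dropHom i.succ) (measurePreserving_dropHom i)
      (dropHom_succ_cons i) h
    have h2 := germMap_mem_germLift_range
      (pullback A (dropHom X n i) (measurePreserving_dropHom i)) (slice X A n h)
    rw [← h1] at h2
    refine germLift_mono ?_ h2
    rintro _ ⟨y, rfl⟩
    exact pullback_dropHom_mem hi y
  exact hle hf

theorem sliceFun_pullback {Φ : (Fin (n + 1) → X) → (Fin n → X)}
    (hΦ : MeasurePreserving Φ (haarProb _) (haarProb _)) {ψ : X → (Fin n → X) → (Fin n → X)}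
    (hψ : ∀ c, MeasurePreserving (ψ c) (haarProb _) (haarProb _))
    (h : ∀ c y, Φ (Fin.cons c y) = ψ c y) (f : MeasFun (Fin n → X) A) :
    ∀ᵐ c ∂haarProb X, sliceFun (pullback A Φ hΦ f) c = pullback A (ψ c) (hψ c) f := by
  filter_upwards [coeFn_sliceFun (coeFn_pullback hΦ f)] with c h1
  refine AEEqFun.ext (h1.trans ?_)
  refine EventuallyEq.trans ?_ (coeFn_pullback (hψ c) f).symm
  simp only [Function.comp_apply, h]
  rfl

theorem sliceFun_diff (v : Fin n → X) (f : MeasFun (Fin (n + 1) → X) A) :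
    ∀ᵐ c ∂haarProb X,
      sliceFun (diff (Fin.cons 0 v : Fin (n + 1) → X) f) c = diff v (sliceFun f c) := by
  have h1 : slice X A n (translate (Fin.cons 0 v : Fin (n + 1) → X) f) =
      germMap _ (translate v) (slice X A n f) := by
    refine slice_pullback _ _ (fun c y => ?_) f
    funext j
    induction j using Fin.cases with
    | zero => simp
    | succ j => simp
  have h2 := map_sub (slice X A n) (translate (Fin.cons 0 v : Fin (n + 1) → X) f) f
  rw [h1] at h2
  exact Germ.coe_eq.1 h2

/-- `f` is killed by all iterated differences in the directions `φ_i`, for `i` in a list. -/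
def IterVanish {G : Type*} [AddCommGroup G] [TopologicalSpace G] [IsTopologicalAddGroup G]
    [CompactSpace G] [MeasurableSpace G] [BorelSpace G] {k : ℕ} (φ : Fin k → X →+ G) :
    List (Fin k) → MeasFun G A → Prop
  | [], f => f = 0
  | i :: l, f => ∀ v : X, IterVanish φ l (diff (φ i v) f)

/-- Differences in the remaining variables commute with slicing. The exceptional null set may depend
on the shift, which is harmless because the shift is fixed before slicing. -/
theorem iterVanish_of_slice [T2Space A] [SecondCountableTopology A] (l : List (Fin n))
    {f : MeasFun (Fin (n + 1) → X) A}
    (hf : ∀ᵐ c ∂haarProb X, IterVanish (AddMonoidHom.single (fun _ : Fin n => X)) l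
      (sliceFun f c)) :
    IterVanish (AddMonoidHom.single (fun _ : Fin (n + 1) => X)) (l.map Fin.succ) f := by
  induction l generalizing f with
  | nil => exact slice_injective hf
  | cons i l ih =>
    intro v
    refine ih ?_
    have h1 : (Pi.single i.succ v : Fin (n + 1) → X) = Fin.cons 0 (Pi.single i v) := by
      funext j
      induction j using Fin.cases with
      | zero => simp
      | succ j => simp [Pi.single_apply]
    have h2 := sliceFun_diff (Pi.single i v) f
    rw [← h1] at h2
    filter_upwards [hf, h2] with c hc h2
    exact (congrArg (IterVanish _ l) h2).mpr (hc v)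

/-- The map `(c, z) ↦ (z_i - c, z)`. -/
def reflectHom (X : Type*) [AddCommGroup X] (n : ℕ) (i : Fin n) :
    (Fin (n + 1) → X) →+ (Fin (n + 1) → X) :=
  AddMonoidHom.mk' (fun w => Fin.cons (w i.succ - w 0) (Fin.tail w)) fun v w => by
    funext j
    induction j using Fin.cases with
    | zero =>
      simp only [Fin.cons_zero, Pi.add_apply]
      abel
    | succ j => rfl

theorem reflectHom_surjective (i : Fin n) : Function.Surjective (reflectHom X n i) := fun w =>
  ⟨reflectHom X n i w, by
    funext j
    induction j using Fin.cases with
    | zero => simp [reflectHom, Fin.tail]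
    | succ j => simp [reflectHom, Fin.tail]⟩

theorem continuous_reflectHom (i : Fin n) : Continuous (reflectHom X n i) := by
  refine continuous_pi fun j => ?_
  induction j using Fin.cases with
  | zero => exact (continuous_apply i.succ).sub (continuous_apply 0)
  | succ j => exact continuous_apply j.succ

theorem measurePreserving_reflectHom (i : Fin n) :
    MeasurePreserving (reflectHom X n i) (haarProb _) (haarProb _) :=
  measurePreserving_of_surjective _ (continuous_reflectHom i) (reflectHom_surjective i)

theorem pullback_reflectHom_mem [T2Space X] {i : Fin (n + 1)} {S : Set (Fin (n + 1))} (hi : i ∉ S)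
    {f : MeasFun (Fin (n + 2) → X) A} (hf : f ∈ coordSum X A (n + 1) (Fin.succ '' S)) :
    pullback A (reflectHom X (n + 1) i) (measurePreserving_reflectHom i) f ∈
      coordSum X A (n + 1) (Fin.succ '' S) := by
  have hle : coordSum X A (n + 1) (Fin.succ '' S) ≤ (coordSum X A (n + 1) (Fin.succ '' S)).comap
      (pullback A (reflectHom X (n + 1) i) (measurePreserving_reflectHom i)) := by
    refine coordSum_le ?_
    rintro _ ⟨j, hj, rfl⟩ h
    have hij : i ≠ j := fun h => hi (h ▸ hj)
    rw [AddSubgroup.mem_comap, pullback_pullback]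
    obtain ⟨y, hy⟩ := range_pullback_le (A := A)
      ((dropHom X (n + 1) j.succ).comp (reflectHom X (n + 1) i)) (dropHom X (n + 1) j.succ)
      ((continuous_dropHom _).comp (continuous_reflectHom i)) (continuous_dropHom _)
      ((dropHom_surjective _).comp (reflectHom_surjective i)) (dropHom_surjective _)
      (fun w hw => by
        -- The kernel of the forgetful map is the axis `j.succ`. There `w 0` and `w i.succ` both
        -- vanish since `i ≠ j`, so the reflection fixes this axis pointwise.
        have h1 : w = reflectHom X (n + 1) i w := by
          have hw' := dropHom_eq_zero hw
          funext k
          induction k using Fin.cases with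
          | zero =>
            change w 0 = w i.succ - w 0
            have h0 : w 0 = 0 := by
              rw [hw', Pi.single_eq_of_ne (Fin.succ_ne_zero j).symm]
            have hi' : w i.succ = 0 := by
              rw [hw', Pi.single_eq_of_ne (by simpa using hij)]
            rw [h0, hi', sub_zero]
          | succ k => rfl
        rw [AddMonoidHom.comp_apply, ← h1, hw])
      ((measurePreserving_dropHom _).comp (measurePreserving_reflectHom i))
      (measurePreserving_dropHom _) ⟨h, rfl⟩
    exact hy ▸ pullback_dropHom_mem (Set.mem_image_of_mem _ hj) y
  exact hle hf

theorem measurePreserving_tail :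
    MeasurePreserving (Fin.tail : (Fin (n + 1) → X) → (Fin n → X)) (haarProb _) (haarProb _) :=
  measurePreserving_dropHom 0

/-- The map `(w, z) ↦ z - φ(w)`. -/
def shiftHom (φ : X →+ (Fin n → X)) : (Fin (n + 1) → X) →+ (Fin n → X) :=
  AddMonoidHom.mk' (fun w => Fin.tail w - φ (w 0)) fun v w => by
    rw [Pi.add_apply, map_add]
    change Fin.tail v + Fin.tail w - _ = _
    abel

theorem measurePreserving_shiftHom (φ : X →+ (Fin n → X)) (hφ : Continuous φ) :
    MeasurePreserving (shiftHom φ) (haarProb _) (haarProb _) :=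
  measurePreserving_of_surjective _
    (Continuous.sub (continuous_pi fun j => continuous_apply j.succ)
      (hφ.comp (continuous_apply 0)))
    fun y => ⟨Fin.cons 0 y, by
      change Fin.tail (Fin.cons 0 y : Fin (n + 1) → X) - φ 0 = y
      rw [map_zero, sub_zero, Fin.tail_cons]⟩

/-- The function `(w, z) ↦ f(z - φ(w)) - f(z)`. -/
def jointDiff (φ : X →+ (Fin n → X)) (hφ : Continuous φ) (f : MeasFun (Fin n → X) A) :
    MeasFun (Fin (n + 1) → X) A :=
  pullback A (shiftHom φ) (measurePreserving_shiftHom φ hφ) f -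
    pullback A Fin.tail measurePreserving_tail f

theorem sliceFun_jointDiff (φ : X →+ (Fin n → X)) (hφ : Continuous φ)
    (f : MeasFun (Fin n → X) A) :
    ∀ᵐ c ∂haarProb X, sliceFun (jointDiff φ hφ f) c = diff (φ c) f := by
  have h1 := sliceFun_pullback (measurePreserving_shiftHom φ hφ)
    (fun c => measurePreserving_sub_right (haarProb (Fin n → X)) (φ c)) (fun c y => rfl) f
  have h2 := Germ.coe_eq.1 (slice_pullback_tail (measurePreserving_tail (X := X) (n := n))
    (fun c y => Fin.tail_cons (α := fun _ => X) c y) f)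
  have h3 := Germ.coe_eq.1 (map_sub (slice X A n)
    (pullback A (shiftHom φ) (measurePreserving_shiftHom φ hφ) f)
    (pullback A Fin.tail measurePreserving_tail f))
  filter_upwards [h1, h2, h3] with c h1 h2 h3
  refine h3.trans ?_
  change sliceFun _ c - sliceFun _ c = _
  rw [h1, h2]
  rfl

theorem continuous_single_pi (i : Fin n) :
    Continuous (AddMonoidHom.single (fun _ : Fin n => X) i) :=
  continuous_single (A := fun _ : Fin n => X) i

/-- The map `y ↦ (y_1, …, y_0, …, y_n)` that moves the first coordinate to position `i`. -/
def moveHom (X : Type*) [AddCommGroup X] (n : ℕ) (i : Fin (n + 1)) :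
    (Fin (n + 1) → X) →+ (Fin (n + 1) → X) :=
  AddMonoidHom.mk' (fun y => i.insertNth (y 0) (Fin.tail y)) fun v w => by
    funext j
    rcases Fin.eq_self_or_eq_succAbove i j with rfl | ⟨j, rfl⟩
    · simp
    · simp [Fin.tail]

theorem measurePreserving_moveHom (i : Fin (n + 1)) :
    MeasurePreserving (moveHom X n i) (haarProb _) (haarProb _) := by
  refine measurePreserving_of_surjective _ (continuous_pi fun j => ?_) fun y => ?_
  · rcases Fin.eq_self_or_eq_succAbove i j with rfl | ⟨j, rfl⟩
    · simpa [moveHom] using continuous_apply 0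
    · simpa [moveHom, Fin.tail] using continuous_apply j.succ
  · refine ⟨Fin.cons (y i) (dropHom X n i y), ?_⟩
    funext j
    rcases Fin.eq_self_or_eq_succAbove i j with rfl | ⟨j, rfl⟩
    · simp [moveHom]
    · simp [moveHom, dropHom_apply]

/-- Induction on the number of directions. The function `F(w, z) = f(z - w e_i) - f(z)` is killed by
the other directions, hence is a sum as claimed. Substituting `w = z_i - c` gives `f(z with z_i
replaced by c) - f(z)`, whose first term does not depend on `z_i`. A generic value of `c` then
yields the decomposition of `f`. -/
theorem mem_coordSum_of_iterVanish [T2Space X] [T2Space A] [SecondCountableTopology A]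
    (l : List (Fin (n + 1))) (hl : l.Nodup) {f : MeasFun (Fin (n + 1) → X) A}
    (hf : IterVanish (AddMonoidHom.single (fun _ : Fin (n + 1) => X)) l f) :
    f ∈ coordSum X A n {i | i ∈ l} := by
  -- The dimension must vary in the induction, since `F` has one more variable than `f`.
  suffices H : ∀ (k : ℕ) (n : ℕ) (l : List (Fin (n + 1))), l.length = k → l.Nodup →
      ∀ f : MeasFun (Fin (n + 1) → X) A,
      IterVanish (AddMonoidHom.single (fun _ : Fin (n + 1) => X)) l f →
      f ∈ coordSum X A n {i | i ∈ l} from H _ n l rfl hl f hf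
  intro k
  induction k with
  | zero =>
    intro n l hk _ f hf
    rw [List.length_eq_zero_iff] at hk
    subst hk
    rw [show f = 0 from hf]
    exact zero_mem _
  | succ k ih =>
    intro n l hk hl f hf
    obtain ⟨i, l, rfl⟩ := List.exists_cons_of_length_eq_add_one hk
    obtain ⟨hil, hl⟩ := List.nodup_cons.1 hl
    set φ := AddMonoidHom.single (fun _ : Fin (n + 1) => X) i
    set F := jointDiff φ (continuous_single_pi i) f
    have h1 := ih (n + 1) (l.map Fin.succ) (by simpa using hk)
      (hl.map (Fin.succ_injective _)) F (by
        refine iterVanish_of_slice l ?_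
        filter_upwards [sliceFun_jointDiff φ (continuous_single_pi i) f] with c hc
        rw [hc]
        exact hf c)
    have hset : {j : Fin (n + 2) | j ∈ l.map Fin.succ} = Fin.succ '' {j | j ∈ l} := by
      ext j; simp
    rw [hset] at h1
    have h2 := pullback_reflectHom_mem (i := i) (by simpa using hil) h1
    have h3 : pullback A (reflectHom X (n + 1) i) (measurePreserving_reflectHom i)
        (pullback A (shiftHom φ) (measurePreserving_shiftHom φ (continuous_single_pi i)) f) =
        pullback A (dropHom X (n + 1) i.succ) (measurePreserving_dropHom i.succ)
          (pullback A (moveHom X n i) (measurePreserving_moveHom i) f) := by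
      rw [pullback_pullback, pullback_pullback]
      refine pullback_congr (funext fun w => funext fun j => ?_) _ _ _
      change w j.succ - Pi.single (M := fun _ => X) i (w i.succ - w 0) j =
        (i.insertNth (w 0) (Fin.tail (dropHom X (n + 1) i.succ w)) : Fin (n + 1) → X) j
      rcases Fin.eq_self_or_eq_succAbove i j with rfl | ⟨j, rfl⟩
      · simp
      · rw [Pi.single_eq_of_ne (Fin.succAbove_ne i j), Fin.insertNth_apply_succAbove]
        simp [Fin.tail, dropHom_apply, Fin.succ_succAbove_succ]
    have h4 : pullback A (reflectHom X (n + 1) i) (measurePreserving_reflectHom i)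
        (pullback A Fin.tail measurePreserving_tail f) =
        pullback A Fin.tail measurePreserving_tail f := by
      rw [pullback_pullback]
      exact pullback_congr (funext fun w => rfl) _ _ _
    have h5 : pullback A Fin.tail measurePreserving_tail f ∈
        coordSum X A (n + 1) (Fin.succ '' {j | j ∈ i :: l}) := by
      have h6 := pullback_dropHom_mem (Set.mem_image_of_mem Fin.succ
        (show i ∈ {j | j ∈ i :: l} by simp))
        (pullback A (moveHom X n i) (measurePreserving_moveHom i) f)
      have h7 := coordSum_mono (Set.image_mono
        (show {j | j ∈ l} ⊆ {j | j ∈ i :: l} from fun j hj => List.mem_cons_of_mem _ hj)) h2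
      have h8 := sub_mem h6 h7
      rwa [show F = _ - _ from rfl, map_sub, h3, h4, sub_sub_cancel] at h8
    have h9 := slice_mem_coordSum h5
    rw [slice_pullback_tail _ (fun c y => Fin.tail_cons (α := fun _ => X) c y)] at h9
    exact const_mem_germLift.1 h9

end Coordinate

/-! ### The acting subgroups -/

section Acting

variable {X : Type*} [AddCommGroup X] {d : ℕ}

theorem actingHom_castSucc (i : Fin d) :
    actingHom X d i.castSucc = AddMonoidHom.single (fun _ : Fin d => X) i := by
  simp [actingHom]

theorem actingHom_last_apply (x : X) (j : Fin d) : actingHom X d (Fin.last d) x j = x := by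
  simp [actingHom]

theorem sum_actingHom_apply (v : Fin (d + 1) → X) (j : Fin d) :
    (∑ k, actingHom X d k (v k)) j = v j.castSucc + v (Fin.last d) := by
  rw [Fin.sum_univ_castSucc, Pi.add_apply, actingHom_last_apply, Finset.sum_apply]
  congr 1
  rw [Finset.sum_eq_single j]
  · rw [actingHom_castSucc]
    simp
  · intro k _ hk
    rw [actingHom_castSucc]
    exact Pi.single_eq_of_ne hk.symm _
  · simp

/-- The only relations between the directions are `(x, …, x, -x)`, so one vanishing entry forces all
to vanish. This gives both the almost independence and the injectivity of `sumHom`. -/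
theorem eq_zero_of_sum_actingHom {v : Fin (d + 1) → X} (h : ∑ k, actingHom X d k (v k) = 0)
    {i : Fin (d + 1)} (hi : v i = 0) : v = 0 := by
  have h1 : ∀ j : Fin d, v j.castSucc + v (Fin.last d) = 0 := fun j => by
    rw [← sum_actingHom_apply, h]; rfl
  have h2 : v (Fin.last d) = 0 := by
    induction i using Fin.lastCases with
    | last => exact hi
    | cast i => simpa [hi] using h1 i
  funext k
  induction k using Fin.lastCases with
  | last => exact h2
  | cast k => simpa [h2] using h1 k

theorem actingSubgroup_almostIndependent (X : Type*) [AddCommGroup X] (d : ℕ) :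
    SubgroupsAlmostIndependent (actingSubgroup X d) := by
  intro e he u hu hsum
  obtain ⟨i, hi⟩ : ∃ i, i ∉ e := by
    by_contra h
    push Not at h
    exact he (Finset.eq_univ_of_forall h)
  have hx : ∀ k, ∃ x : X, (k ∈ e → actingHom X d k x = u k) ∧ (k ∉ e → x = 0) := fun k => by
    by_cases hk : k ∈ e
    · obtain ⟨x, hx⟩ := hu k hk
      exact ⟨x, fun _ => hx, fun h => absurd hk h⟩
    · exact ⟨0, fun h => absurd h hk, fun _ => rfl⟩
  choose v hv hv0 using hx
  have hv' : v = 0 := by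
    refine eq_zero_of_sum_actingHom ?_ (hv0 i hi)
    rw [← hsum, ← Finset.sum_subset (Finset.subset_univ e)]
    · exact Finset.sum_congr rfl hv
    · intro k _ hk
      rw [hv0 k hk, map_zero]
  intro k hk
  rw [← hv k hk, hv', Pi.zero_apply, map_zero]

/-- The homomorphism `w ↦ ∑_{j ≠ i} φ_j(w_j)`, where `φ_j` parametrizes the acting subgroups. -/
def sumHom (X : Type*) [AddCommGroup X] (d : ℕ) (i : Fin (d + 1)) :
    (Fin d → X) →+ (Fin d → X) :=
  AddMonoidHom.mk' (fun w => ∑ j : Fin d, actingHom X d (i.succAbove j) (w j)) fun v w => by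
    simp [Finset.sum_add_distrib]

theorem sumHom_apply (i : Fin (d + 1)) (w : Fin d → X) :
    sumHom X d i w = ∑ j : Fin d, actingHom X d (i.succAbove j) (w j) := rfl

theorem sumHom_single (i : Fin (d + 1)) (j : Fin d) (x : X) :
    sumHom X d i (Pi.single j x) = actingHom X d (i.succAbove j) x := by
  rw [sumHom_apply, Finset.sum_eq_single j]
  · simp
  · intro k _ hk
    rw [Pi.single_eq_of_ne hk, map_zero]
  · simp

theorem sumHom_eq (i : Fin (d + 1)) (v : Fin (d + 1) → X) (hv : v i = 0) :
    sumHom X d i (fun j => v (i.succAbove j)) = ∑ k, actingHom X d k (v k) := by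
  rw [Fin.sum_univ_succAbove _ i, hv, map_zero, zero_add]
  rfl

theorem sumHom_bijective (i : Fin (d + 1)) : Function.Bijective (sumHom X d i) := by
  constructor
  · rw [injective_iff_map_eq_zero]
    intro w hw
    have h1 := sumHom_eq i (i.insertNth 0 w : Fin (d + 1) → X) (by simp)
    simp only [Fin.insertNth_apply_succAbove] at h1
    have h2 := eq_zero_of_sum_actingHom (h1.symm.trans hw) (i := i) (by simp)
    funext j
    simpa using congrFun h2 (i.succAbove j)
  · intro z
    -- Every `z` is the sum of the coordinate entries `z j - c` and the diagonal entry `c`; the free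
    -- `c` is chosen to make the `i`-th entry vanish.
    obtain ⟨c, hc⟩ : ∃ c : X,
        (Fin.snoc (fun j => z j - c) c : Fin (d + 1) → X) i = 0 := by
      induction i using Fin.lastCases with
      | last => exact ⟨0, by simp⟩
      | cast i => exact ⟨z i, by simp⟩
    refine ⟨_, (sumHom_eq i _ hc).trans ?_⟩
    funext j
    rw [sum_actingHom_apply]
    simp

theorem continuous_actingHom [TopologicalSpace X] (i : Fin (d + 1)) :
    Continuous (actingHom X d i) := by
  induction i using Fin.lastCases with
  | last =>
    refine continuous_pi fun j => ?_
    simp only [actingHom_last_apply]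
    exact continuous_id
  | cast i =>
    rw [actingHom_castSucc]
    exact continuous_single (A := fun _ : Fin d => X) i

theorem continuous_sumHom [TopologicalSpace X] [IsTopologicalAddGroup X] (i : Fin (d + 1)) :
    Continuous (sumHom X d i) :=
  continuous_finsetSum Finset.univ fun j _ =>
    (continuous_actingHom (i.succAbove j)).comp (continuous_apply j)

theorem exists_continuousAddEquiv [TopologicalSpace X] [IsTopologicalAddGroup X] [CompactSpace X]
    [T2Space X] (i : Fin (d + 1)) : ∃ e : (Fin d → X) ≃ₜ+ (Fin d → X),
      ∀ w : Fin d → X, e w = ∑ j : Fin d, actingHom X d (i.succAbove j) (w j) := by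
  let e : (Fin d → X) ≃+ (Fin d → X) := AddEquiv.ofBijective (sumHom X d i) (sumHom_bijective i)
  have he : Continuous e.toEquiv := continuous_sumHom i
  exact ⟨{ e with
    continuous_toFun := he
    continuous_invFun := (Continuous.homeoOfEquivCompactToT2 he).symm.continuous }, fun w => rfl⟩

end Acting

/-! ### Iterated differences -/

section IterVanish

variable {X : Type*} [AddCommGroup X]
  {G H : Type*} [AddCommGroup G] [TopologicalSpace G] [IsTopologicalAddGroup G]
  [CompactSpace G] [MeasurableSpace G] [BorelSpace G]
  [AddCommGroup H] [TopologicalSpace H] [IsTopologicalAddGroup H]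
  [CompactSpace H] [MeasurableSpace H] [BorelSpace H]
  {A : Type*} [AddCommGroup A] [TopologicalSpace A] [IsTopologicalAddGroup A] {k : ℕ}

theorem pullback_bijective [T2Space H] (φ : G →+ H) (hc : Continuous φ)
    (hb : Function.Bijective φ) (hm : MeasurePreserving φ (haarProb G) (haarProb H)) :
    Function.Bijective (pullback A φ hm) := by
  let e : G ≃+ H := AddEquiv.ofBijective φ hb
  have he : Continuous e.toEquiv := hc
  have hm' : MeasurePreserving e.symm (haarProb H) (haarProb G) :=
    measurePreserving_of_surjective e.symm.toAddMonoidHom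
      (Continuous.homeoOfEquivCompactToT2 he).symm.continuous e.symm.surjective
  refine Function.bijective_iff_has_inverse.2 ⟨pullback A e.symm hm', fun f => ?_, fun f => ?_⟩
  · rw [pullback_pullback]
    exact pullback_id (funext fun x => e.apply_symm_apply x) _ _
  · rw [pullback_pullback]
    exact pullback_id (funext fun x => e.symm_apply_apply x) _ _

theorem pullback_diff (φ : G →+ H) (hm : MeasurePreserving φ (haarProb G) (haarProb H)) (v : G)
    (f : MeasFun H A) : pullback A φ hm (diff (φ v) f) = diff v (pullback A φ hm f) := by
  change pullback A φ hm (translate (φ v) f - f) = translate v (pullback A φ hm f) - _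
  rw [map_sub]
  congr 1
  unfold translate
  rw [pullback_pullback, pullback_pullback]
  exact pullback_congr (funext fun x => (map_sub φ x v).symm) _ _ _

theorem diff_pullback_eq_zero (φ : G →+ H) (hm : MeasurePreserving φ (haarProb G) (haarProb H))
    {v : G} (hv : φ v = 0) (f : MeasFun H A) : diff v (pullback A φ hm f) = 0 := by
  rw [← pullback_diff, hv]
  change pullback A φ hm (translate 0 f - f) = 0
  have : translate 0 f = f := pullback_id (funext fun x => sub_zero x) _ f
  rw [this, sub_self, map_zero]

theorem diff_add (v w : G) (f : MeasFun G A) :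
    diff (v + w) f = diff v (diff w f) + diff v f + diff w f := by
  have h : translate (v + w) f = translate v (translate w f) := by
    unfold translate
    rw [pullback_pullback]
    exact pullback_congr (funext fun x => (sub_sub x v w).symm) _ _ _
  change translate (v + w) f - f =
    (translate v (translate w f - f) - (translate w f - f)) + (translate v f - f) +
      (translate w f - f)
  rw [map_sub, h]
  abel

theorem iterVanish_pullback {k' : ℕ} (φ : Fin k → X →+ H) (ψ : Fin k' → X →+ G)
    (σ : Fin k' → Fin k) (ε : G →+ H) (hm : MeasurePreserving ε (haarProb G) (haarProb H))
    (hε : ∀ i x, ε (ψ i x) = φ (σ i) x) (l : List (Fin k')) {f : MeasFun H A}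
    (hf : IterVanish φ (l.map σ) f) : IterVanish ψ l (pullback A ε hm f) := by
  induction l generalizing f with
  | nil =>
    change pullback A ε hm f = 0
    rw [show f = 0 from hf, map_zero]
  | cons i l ih =>
    intro v
    rw [← pullback_diff, hε]
    exact ih (hf v)

theorem iterVanish_of_prod (φ : Fin k → X →+ G) {l : List (Fin k)} (hl : l.Nodup)
    {f : MeasFun G A}
    (hf : ∀ u : Fin k → X,
      ((l.map fun i => diff (φ i (u i))).prod : AddMonoid.End (MeasFun G A)) f = 0) :
    IterVanish φ l f := by
  induction l generalizing f with
  | nil => exact hf 0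
  | cons i l ih =>
    obtain ⟨hil, hl⟩ := List.nodup_cons.1 hl
    refine fun v => ih hl fun u => ?_
    -- As `i` does not recur in `l`, its shift can be prescribed without touching the others.
    have h1 := hf (Function.update u i v)
    rw [List.map_cons, List.prod_cons, Function.update_self,
      (List.map_congr_left fun j hj => by
        rw [Function.update_of_ne (fun h : j = i => hil (h ▸ hj))] :
        l.map (fun j => (diff (φ j (Function.update u i v j)) : AddMonoid.End (MeasFun G A))) =
          l.map fun j => diff (φ j (u j)))] at h1
    have hcomm : Commute (diff (φ i v))
        ((l.map fun j => diff (φ j (u j))).prod : AddMonoid.End (MeasFun G A)) := by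
      refine Commute.list_prod_right _ _ fun g hg => ?_
      obtain ⟨j, _, rfl⟩ := List.mem_map.1 hg
      exact diff_commute _ _
    rw [hcomm.eq] at h1
    exact h1

theorem iterDiff_eq_prod (u : Fin k → G) {e : Finset (Fin k)} {l : List (Fin k)} (hl : l.Nodup)
    (hle : l.toFinset = e) :
    (iterDiff u e : AddMonoid.End (MeasFun G A)) = (l.map fun i => diff (u i)).prod := by
  unfold iterDiff
  refine List.Perm.prod_eq' (List.Perm.map _ ?_) ?_
  · rw [← Multiset.coe_eq_coe, Finset.sort_eq, ← hle, List.toFinset_val, hl.dedup]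
  · rw [List.pairwise_map]
    exact List.pairwise_of_forall fun _ _ => diff_commute _ _

theorem iterVanish_of_mem_solutions (φ : Fin k → X →+ G) {e : Finset (Fin k)}
    {l : List (Fin k)} (hl : l.Nodup) (hle : l.toFinset = e) {f : MeasFun G A}
    (hf : f ∈ solutions A (fun i => (φ i).range) e) : IterVanish φ l f :=
  iterVanish_of_prod φ hl fun u => by
    rw [← iterDiff_eq_prod (fun i => φ i (u i)) hl hle]
    exact hf _ fun i _ => ⟨u i, rfl⟩

theorem mem_solutions_of_singleton (U : Fin k → AddSubgroup G) {e : Finset (Fin k)} {i : Fin k}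
    (hi : i ∈ e) {f : MeasFun G A} (hf : ∀ v ∈ U i, diff v f = 0) : f ∈ solutions A U e := by
  refine solutions_mono U (Finset.singleton_subset_iff.2 hi) fun u hu => ?_
  simp only [iterDiff, Finset.sort_singleton, List.map_cons, List.map_nil, List.prod_cons,
    List.prod_nil, mul_one]
  exact hf _ (hu i (Finset.mem_singleton_self i))

theorem diff_mem_solutions (U : Fin k → AddSubgroup G) {e : Finset (Fin k)} (v : G)
    {f : MeasFun G A} (hf : f ∈ solutions A U e) : diff v f ∈ solutions A U e := fun u hu => by
  have hcomm : Commute (diff v) (iterDiff u e : AddMonoid.End (MeasFun G A)) := by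
    refine Commute.list_prod_right _ _ fun g hg => ?_
    obtain ⟨j, _, rfl⟩ := List.mem_map.1 hg
    exact diff_commute _ _
  change (iterDiff u e * diff v : AddMonoid.End (MeasFun G A)) f = 0
  rw [← hcomm.eq]
  change diff v (iterDiff u e f) = 0
  rw [hf u hu, map_zero]

theorem mem_solutions_of_diff_mem (U : Fin k → AddSubgroup G) {e : Finset (Fin k)} {i : Fin k}
    (hi : i ∈ e) {f : MeasFun G A} (hf : ∀ v ∈ U i, diff v f ∈ solutions A U (e.erase i)) :
    f ∈ solutions A U e := fun u hu => by
  rw [iterDiff_of_subset u (Finset.singleton_subset_iff.2 hi), Finset.sdiff_singleton_eq_erase]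
  change iterDiff u (e.erase i) (iterDiff u {i} f) = 0
  simp only [iterDiff, Finset.sort_singleton, List.map_cons, List.map_nil, List.prod_cons,
    List.prod_nil, mul_one]
  exact hf _ (hu i hi) u fun j hj => hu j (Finset.mem_of_mem_erase hj)

/-- A difference condition that holds for almost all elements of a one-parameter family holds for
all of them. -/
theorem diff_mem_solutions_of_ae [TopologicalSpace X] [IsTopologicalAddGroup X] [CompactSpace X]
    [MeasurableSpace X] [BorelSpace X] [SecondCountableTopology X]
    (U : Fin k → AddSubgroup G) {e : Finset (Fin k)} (φ : X →+ G)
    {f : MeasFun G A} (hf : ∀ᵐ c ∂haarProb X, diff (φ c) f ∈ solutions A U e) (x : X) :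
    diff (φ x) f ∈ solutions A U e := by
  have hneg : MeasurePreserving (-AddMonoidHom.id X : X →+ X) (haarProb X) (haarProb X) :=
    measurePreserving_of_surjective _ continuous_neg neg_surjective
  -- Every `x` is a sum of two elements `c` and `x - c` of the given conull set, and `diff_add`
  -- shows that the condition passes to sums.
  have h1 : ∀ᵐ c ∂haarProb X, diff (φ (x - c)) f ∈ solutions A U e := by
    have := ((measurePreserving_add_left (haarProb X) x).comp hneg).quasiMeasurePreserving.ae hf
    filter_upwards [this] with c hc
    rw [sub_eq_add_neg]
    exact hc
  obtain ⟨c, hc, hc'⟩ := (hf.and h1).exists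
  have : diff (φ x) f = diff (φ c) (diff (φ (x - c)) f) + diff (φ c) f + diff (φ (x - c)) f := by
    rw [← diff_add, ← map_add, add_sub_cancel]
  rw [this]
  exact add_mem (add_mem (diff_mem_solutions U _ hc') hc) hc'

end IterVanish

/-! ### Degenerate solutions -/

section Degenerate

variable {G : Type*} [AddCommGroup G] [TopologicalSpace G] [IsTopologicalAddGroup G]
  [CompactSpace G] [MeasurableSpace G] [BorelSpace G]
  {A : Type*} [AddCommGroup A] [TopologicalSpace A] [IsTopologicalAddGroup A] {d : ℕ}

theorem topEval_boundary (U : Fin (d + 1) → AddSubgroup G) (m : SolutionSum A U d) :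
    ((topEval A U (boundary A U d m) : solutions A U Finset.univ) : MeasFun G A) =
      ∑ i : {i : Fin (d + 1) // i ∈ Finset.univ},
        (-1 : ℤ) ^ (Finset.univ.filter (· < i.1)).card •
          (m ⟨Finset.univ.erase i.1, by simp⟩ : MeasFun G A) := by
  change ((∑ i : {i : Fin (d + 1) // i ∈ Finset.univ}, _ : solutions A U Finset.univ) :
    MeasFun G A) = _
  rw [AddSubgroup.val_finsetSum]
  rfl

/-- The signs in the boundary map are units, so they do not affect its image. -/
theorem map_degenerate (U : Fin (d + 1) → AddSubgroup G) :
    (degenerate A U).map (solutions A U Finset.univ).subtype =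
      ⨆ i : Fin (d + 1), solutions A U (Finset.univ.erase i) := by
  classical
  apply le_antisymm
  · rintro _ ⟨_, ⟨m, rfl⟩, rfl⟩
    change ((topEval A U (boundary A U d m) : solutions A U Finset.univ) : MeasFun G A) ∈ _
    rw [topEval_boundary]
    exact sum_mem fun i _ => zsmul_mem (AddSubgroup.mem_iSup_of_mem i.1 (Subtype.property _)) _
  · refine iSup_le fun i f hf => ?_
    set s : ℤ := (-1 : ℤ) ^ (Finset.univ.filter (· < i)).card with hs
    have hss : s * s = 1 := by rw [hs, ← mul_pow]; simp
    let a : {a : Finset (Fin (d + 1)) // a.card = d} := ⟨Finset.univ.erase i, by simp⟩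
    let m : SolutionSum A U d := Pi.single a (s • ⟨f, hf⟩)
    refine ⟨topEval A U (boundary A U d m), ⟨m, rfl⟩, ?_⟩
    change ((topEval A U (boundary A U d m) : solutions A U Finset.univ) : MeasFun G A) = f
    rw [topEval_boundary, Finset.sum_eq_single ⟨i, Finset.mem_univ i⟩]
    · change s • ((m a : solutions A U _) : MeasFun G A) = f
      simp only [m, Pi.single_eq_same]
      change s • s • f = f
      rw [smul_smul, hss, one_smul]
    · rintro ⟨j, hj⟩ _ hji
      have hne : (⟨Finset.univ.erase j, by simp⟩ :
          {a : Finset (Fin (d + 1)) // a.card = d}) ≠ a := fun h => by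
        have h' : Finset.univ.erase j = Finset.univ.erase i := congrArg Subtype.val h
        refine hji (Subtype.ext ?_)
        by_contra hji'
        have : j ∈ Finset.univ.erase i := Finset.mem_erase.2 ⟨hji', Finset.mem_univ j⟩
        rw [← h'] at this
        exact Finset.notMem_erase _ _ this
      have hz : m ⟨Finset.univ.erase j, by simp⟩ = 0 := Pi.single_eq_of_ne hne _
      change _ • ((m ⟨Finset.univ.erase j, _⟩ : solutions A U _) : MeasFun G A) = 0
      rw [hz]
      exact smul_zero _
    · exact fun h => absurd (Finset.mem_univ _) h

end Degenerate

/-! ### Matching face maps with the acting subgroups in normalised homogeneous coordinates. -/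

section Base

variable {X : Type*} [AddCommGroup X] {n : ℕ}

/-- The inhomogeneous coordinates of `(z_1, …, z_n, 0)`. -/
def baseHom (X : Type*) [AddCommGroup X] (n : ℕ) : (Fin n → X) →+ (Fin n → X) :=
  AddMonoidHom.mk' (fun z => bar n (Fin.snoc z 0 : Fin (n + 1) → X)) fun v w => by
    rw [← map_add]
    congr 1
    funext j
    induction j using Fin.lastCases with
    | last => simp
    | cast j => simp

theorem baseHom_apply (z : Fin n → X) :
    baseHom X n z = bar n (Fin.snoc z 0 : Fin (n + 1) → X) := rfl

theorem eq_zero_of_bar_comp_succAbove {i : Fin (n + 2)} (hi : i ≠ Fin.last _)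
    {g : Fin (n + 2) → X} (hg : g (Fin.last _) = 0) (h : bar n (g ∘ i.succAbove) = 0)
    {k : Fin (n + 2)} (hk : k ≠ i) : g k = 0 := by
  obtain ⟨k, rfl⟩ := Fin.exists_succAbove_eq hk
  obtain ⟨m, hm⟩ := Fin.exists_succAbove_eq hi.symm
  rw [← hg, ← hm]
  exact (bar_eq_zero h k).trans (bar_eq_zero h m).symm

theorem bar_comp_succAbove_eq_zero {i : Fin (n + 2)} {g : Fin (n + 2) → X}
    (h : ∀ k, k ≠ i → g k = 0) : bar n (g ∘ i.succAbove) = 0 := by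
  rw [show g ∘ i.succAbove = 0 from funext fun j => h _ (Fin.succAbove_ne i j), map_zero]

/-- The face maps as homomorphisms. -/
def faceHom (X : Type*) [AddCommGroup X] (n : ℕ) (i : Fin (n + 2)) :
    (Fin (n + 1) → X) →+ (Fin n → X) :=
  AddMonoidHom.mk' (faceMap X n i) (faceMap_add X n i)

theorem faceHom_baseHom (i : Fin (n + 2)) (z : Fin (n + 1) → X) :
    faceHom X n i (baseHom X (n + 1) z) =
      bar n ((Fin.snoc z 0 : Fin (n + 2) → X) ∘ i.succAbove) :=
  faceMap_bar i _

/-- Deleting position `i` from `(0, …, x, …, 0, 0)` leaves zeros, and deleting the last entry from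
`(x, …, x, 0)` leaves a constant; both have zero differences. The converse is
`exists_actingHom_of_faceHom_baseHom`. -/
theorem faceHom_baseHom_actingHom (i : Fin (n + 2)) (x : X) :
    faceHom X n i (baseHom X (n + 1) (actingHom X (n + 1) i x)) = 0 := by
  rw [faceHom_baseHom]
  induction i using Fin.lastCases with
  | last =>
    rw [← bar_const x]
    congr 1
    funext j
    simp [actingHom_last_apply]
  | cast i =>
    refine bar_comp_succAbove_eq_zero fun k hk => ?_
    induction k using Fin.lastCases with
    | last => simp
    | cast k =>
      rw [Fin.snoc_castSucc, actingHom_castSucc]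
      exact Pi.single_eq_of_ne (fun h => hk (congrArg _ h)) _

theorem exists_actingHom_of_faceHom_baseHom {i : Fin (n + 2)} {z : Fin (n + 1) → X}
    (h : faceHom X n i (baseHom X (n + 1) z) = 0) : ∃ x, z = actingHom X (n + 1) i x := by
  rw [faceHom_baseHom] at h
  induction i using Fin.lastCases with
  | last =>
    refine ⟨z 0, funext fun j => ?_⟩
    rw [actingHom_last_apply]
    have := bar_eq_zero h j
    simp only [Function.comp_apply, Fin.succAbove_last] at this
    rwa [Fin.snoc_castSucc (α := fun _ => X), Fin.snoc_castSucc (α := fun _ => X)] at this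
  | cast i =>
    refine ⟨z i, funext fun j => ?_⟩
    rw [actingHom_castSucc]
    change z j = Pi.single (M := fun _ => X) i (z i) j
    by_cases hij : j = i
    · subst hij; simp
    · rw [Pi.single_eq_of_ne hij]
      have := eq_zero_of_bar_comp_succAbove (Fin.castSucc_ne_last i)
        (Fin.snoc_last (α := fun _ => X) 0 z) h
        (k := j.castSucc) (fun h => hij (Fin.castSucc_injective _ h))
      rwa [Fin.snoc_castSucc (α := fun _ => X)] at this

theorem baseHom_bijective : Function.Bijective (baseHom X n) := by
  constructor
  · rw [injective_iff_map_eq_zero]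
    intro z hz
    funext j
    have h1 := bar_eq_zero hz j.castSucc
    have h2 := bar_eq_zero hz (Fin.last n)
    rw [← h2, Fin.snoc_castSucc (α := fun _ => X), Fin.snoc_last (α := fun _ => X)] at h1
    exact h1
  · intro x
    refine ⟨fun j => Fin.partialSum x j.castSucc - Fin.partialSum x (Fin.last n), ?_⟩
    rw [baseHom_apply, ← bar_add_const _ (Fin.partialSum x (Fin.last n))]
    conv_rhs => rw [← bar_partialSum x]
    congr 1
    funext j
    induction j using Fin.lastCases with
    | last => simp
    | cast j => simp

theorem continuous_snoc_zero [TopologicalSpace X] :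
    Continuous (fun z : Fin n → X => (Fin.snoc z 0 : Fin (n + 1) → X)) := by
  refine continuous_pi fun j => ?_
  induction j using Fin.lastCases with
  | last => simpa using continuous_const
  | cast j => simpa using continuous_apply j

theorem continuous_baseHom [TopologicalSpace X] [IsTopologicalAddGroup X] :
    Continuous (baseHom X n) :=
  continuous_bar.comp continuous_snoc_zero

/-- The map that moves the first coordinate to the last position, followed by `baseHom`. -/
def jointHom (X : Type*) [AddCommGroup X] (n : ℕ) : (Fin (n + 1) → X) →+ (Fin (n + 1) → X) :=
  (baseHom X (n + 1)).comp
    (AddMonoidHom.mk' (fun w => (Fin.snoc (Fin.tail w) (w 0) : Fin (n + 1) → X)) fun v w => by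
      funext j
      induction j using Fin.lastCases with
      | last => simp
      | cast j => simp [Fin.tail])

theorem jointHom_apply (w : Fin (n + 1) → X) :
    jointHom X n w = baseHom X (n + 1) (Fin.snoc (Fin.tail w) (w 0) : Fin (n + 1) → X) := rfl

theorem jointHom_bijective : Function.Bijective (jointHom X n) := by
  refine baseHom_bijective.comp ⟨fun v w h => ?_, fun y => ?_⟩
  · have h : (Fin.snoc (Fin.tail v) (v 0) : Fin (n + 1) → X) = Fin.snoc (Fin.tail w) (w 0) := h
    funext j
    induction j using Fin.cases with
    | zero => simpa using congrFun h (Fin.last n)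
    | succ j => simpa [Fin.tail] using congrFun h j.castSucc
  · refine ⟨Fin.cons (y (Fin.last n)) (Fin.init y), ?_⟩
    change (Fin.snoc (Fin.tail (Fin.cons _ _ : Fin (n + 1) → X)) _ : Fin (n + 1) → X) = y
    rw [Fin.tail_cons, Fin.cons_zero, Fin.snoc_init_self]

theorem continuous_jointHom [TopologicalSpace X] [IsTopologicalAddGroup X] :
    Continuous (jointHom X n) := by
  refine continuous_baseHom.comp (continuous_pi fun j => ?_)
  induction j using Fin.lastCases with
  | last => simpa using continuous_apply 0
  | cast j => simpa [Fin.tail] using continuous_apply j.succ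

/-- The homogeneous coordinates are `(z, w_0, 0)` with `z` the tail of `w`. Deleting the final 0
leaves `(z, w_0)`, which renormalises to `(z - w_0, 0)`: a diagonal translate of `z`. -/
theorem faceMap_jointHom_last (w : Fin (n + 2) → X) :
    faceMap X (n + 1) (Fin.last _) (jointHom X (n + 1) w) =
      baseHom X (n + 1) (Fin.tail w - actingHom X (n + 1) (Fin.last _) (w 0)) := by
  rw [jointHom_apply, baseHom_apply, faceMap_bar, baseHom_apply, ← bar_add_const (Fin.snoc _ _)
    (w 0)]
  congr 1
  funext j
  simp only [Function.comp_apply, Fin.succAbove_last]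
  rw [Fin.snoc_castSucc (α := fun _ => X)]
  induction j using Fin.lastCases with
  | last => simp
  | cast j => simp [actingHom_last_apply]

theorem faceMap_jointHom_castSucc_last (w : Fin (n + 2) → X) :
    faceMap X (n + 1) (Fin.last _).castSucc (jointHom X (n + 1) w) =
      baseHom X (n + 1) (Fin.tail w) := by
  rw [jointHom_apply, baseHom_apply, faceMap_bar, baseHom_apply]
  congr 1
  funext j
  induction j using Fin.lastCases with
  | last =>
    rw [Function.comp_apply, Fin.succAbove_castSucc_self, Fin.succ_last,
      Fin.snoc_last (α := fun _ => X), Fin.snoc_last (α := fun _ => X)]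
  | cast j =>
    rw [Function.comp_apply, Fin.succAbove_of_castSucc_lt _ _
      (Fin.castSucc_lt_castSucc_iff.2 (Fin.castSucc_lt_last j)), Fin.snoc_castSucc (α := fun _ => X),
      Fin.snoc_castSucc (α := fun _ => X), Fin.snoc_castSucc (α := fun _ => X)]

theorem faceHom_jointHom_eq_zero_iff (j : Fin (n + 1)) (w : Fin (n + 2) → X) :
    faceHom X (n + 1) j.castSucc.castSucc (jointHom X (n + 1) w) = 0 ↔
      dropHom X (n + 1) j.succ w = 0 := by
  rw [jointHom_apply, faceHom_baseHom]
  constructor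
  · intro h
    have h0 : ∀ k, k ≠ j.castSucc.castSucc →
        (Fin.snoc (Fin.snoc (Fin.tail w) (w 0) : Fin (n + 2) → X) 0 : Fin (n + 3) → X) k = 0 :=
      fun k hk => eq_zero_of_bar_comp_succAbove (Fin.castSucc_ne_last _)
        (Fin.snoc_last (α := fun _ => X) _ _) h hk
    funext k
    rw [dropHom_apply]
    have hne := Fin.succAbove_ne j.succ k
    generalize j.succ.succAbove k = m at hne
    induction m using Fin.cases with
    | zero =>
      have := h0 (Fin.last _).castSucc
        (fun h => Fin.castSucc_ne_last j (Fin.castSucc_injective _ h).symm)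
      rwa [Fin.snoc_castSucc (α := fun _ => X), Fin.snoc_last (α := fun _ => X)] at this
    | succ m =>
      have := h0 m.castSucc.castSucc (fun h => hne (congrArg Fin.succ
        (Fin.castSucc_injective _ (Fin.castSucc_injective _ h))))
      rwa [Fin.snoc_castSucc (α := fun _ => X), Fin.snoc_castSucc (α := fun _ => X)] at this
  · intro h
    refine bar_comp_succAbove_eq_zero fun k hk => ?_
    have hw := dropHom_eq_zero h
    induction k using Fin.lastCases with
    | last => simp
    | cast k =>
      rw [Fin.snoc_castSucc (α := fun _ => X)]
      induction k using Fin.lastCases with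
      | last =>
        rw [Fin.snoc_last (α := fun _ => X), hw, Pi.single_eq_of_ne (Fin.succ_ne_zero j).symm]
      | cast k =>
        rw [Fin.snoc_castSucc (α := fun _ => X)]
        change w k.succ = 0
        rw [hw, Pi.single_eq_of_ne]
        exact fun h => hk (by rw [Fin.succ_injective _ h])

end Base

/-! ### Solutions and cocycles -/

section Main

variable {X : Type*} [AddCommGroup X] [TopologicalSpace X] [IsTopologicalAddGroup X]
  [CompactSpace X] [T2Space X] [SecondCountableTopology X] [MeasurableSpace X] [BorelSpace X]
  {A : Type*} [AddCommGroup A] [TopologicalSpace A] [IsTopologicalAddGroup A] {n : ℕ}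

theorem measurePreserving_baseHom :
    MeasurePreserving (baseHom X n) (haarProb _) (haarProb _) :=
  measurePreserving_of_surjective _ continuous_baseHom baseHom_bijective.2

theorem measurePreserving_jointHom :
    MeasurePreserving (jointHom X n) (haarProb _) (haarProb _) :=
  measurePreserving_of_surjective _ continuous_jointHom jointHom_bijective.2

variable (X A) in
/-- The identification of cochains with functions on `Xⁿ` by the change of variables `baseHom`. -/
def basePull (n : ℕ) : Cochain X A n →+ MeasFun (Fin n → X) A :=
  pullback A (baseHom X n) measurePreserving_baseHom

theorem basePull_bijective : Function.Bijective (basePull X A n) :=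
  pullback_bijective _ continuous_baseHom baseHom_bijective _

theorem diff_basePull_coface (i : Fin (n + 2)) (x : X) (h : Cochain X A n) :
    diff (actingHom X (n + 1) i x) (basePull X A (n + 1) (coface X A n i h)) = 0 := by
  have h1 := diff_pullback_eq_zero (A := A) ((faceHom X n i).comp (baseHom X (n + 1)))
    ((faceMap_measurePreserving X n i).comp measurePreserving_baseHom)
    (faceHom_baseHom_actingHom i x) h
  have h2 : basePull X A (n + 1) (coface X A n i h) = pullback A _
      ((faceMap_measurePreserving X n i).comp measurePreserving_baseHom) h :=
    pullback_pullback _ _ h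
  rw [h2]
  exact h1

/-- The coordinates `sumHom` turn the remaining subgroups into the axes, where the decomposition for
coordinate directions applies. A function independent of axis `j` factors through the face map of
index `i.succAbove j`, whose kernel is that axis. -/
theorem solutions_erase_le [T2Space A] [SecondCountableTopology A] (i : Fin (n + 2)) :
    solutions A (actingSubgroup X (n + 1)) (Finset.univ.erase i) ≤
      (lowFaces X A n (n + 2)).map (basePull X A (n + 1)) := by
  intro f hf
  have hm : MeasurePreserving (sumHom X (n + 1) i) (haarProb _) (haarProb _) :=
    measurePreserving_of_surjective _ (continuous_sumHom i) (sumHom_bijective i).2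
  have h1 : IterVanish (actingHom X (n + 1)) ((List.finRange (n + 1)).map i.succAbove) f := by
    refine iterVanish_of_mem_solutions (actingHom X (n + 1))
      ((List.nodup_finRange _).map Fin.succAbove_right_injective) ?_ hf
    ext k
    simp [Fin.exists_succAbove_eq_iff]
  have h2 := mem_coordSum_of_iterVanish _ (List.nodup_finRange _)
    (iterVanish_pullback (actingHom X (n + 1)) (AddMonoidHom.single (fun _ : Fin (n + 1) => X))
      i.succAbove (sumHom X (n + 1) i) hm (fun j x => sumHom_single i j x) _ h1)
  have h3 : coordSum X A n {j | j ∈ List.finRange (n + 1)} ≤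
      ((lowFaces X A n (n + 2)).map (basePull X A (n + 1))).map
        (pullback A (sumHom X (n + 1) i) hm) := by
    refine coordSum_le fun j _ h => ?_
    obtain ⟨y, hy⟩ := range_pullback_le (A := A) (dropHom X n j)
      (((faceHom X n (i.succAbove j)).comp (baseHom X (n + 1))).comp (sumHom X (n + 1) i))
      (continuous_dropHom j)
      ((faceMap_continuous X n _).comp (continuous_baseHom.comp (continuous_sumHom i)))
      (dropHom_surjective j)
      ((faceMap_surjective X n _).comp (baseHom_bijective.2.comp (sumHom_bijective i).2))
      (fun w hw => by
        obtain ⟨x, hx⟩ := exists_actingHom_of_faceHom_baseHom (i := i.succAbove j)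
          (z := sumHom X (n + 1) i w) hw
        rw [← sumHom_single] at hx
        rw [(sumHom_bijective i).1 hx, dropHom_single])
      (measurePreserving_dropHom j)
      (((faceMap_measurePreserving X n _).comp measurePreserving_baseHom).comp hm) ⟨h, rfl⟩
    rw [← hy]
    refine ⟨_, ⟨coface X A n (i.succAbove j) y, coface_mem_lowFaces (Fin.is_lt _) y, rfl⟩, ?_⟩
    unfold basePull coface
    rw [pullback_pullback, pullback_pullback]
    rfl
  obtain ⟨g, hg, hgf⟩ := h3 h2
  rwa [← (pullback_bijective _ (continuous_sumHom i) (sumHom_bijective i) hm).1 hgf]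

theorem map_degenerate_actingSubgroup [T2Space A] [SecondCountableTopology A] :
    (degenerate A (actingSubgroup X (n + 1))).map
        (solutions A (actingSubgroup X (n + 1)) Finset.univ).subtype =
      (lowFaces X A n (n + 2)).map (basePull X A (n + 1)) := by
  rw [map_degenerate]
  refine le_antisymm (iSup_le solutions_erase_le) ?_
  rw [AddSubgroup.map_le_iff_le_comap]
  refine lowFaces_le fun i _ h => ?_
  -- Invariance under the `i`-th subgroup solves every equation that involves it, so any `j ≠ i` may
  -- be omitted.
  obtain ⟨j, hj⟩ := exists_ne i
  refine AddSubgroup.mem_iSup_of_mem j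
    (mem_solutions_of_singleton _ (i := i) (Finset.mem_erase.2 ⟨hj.symm, Finset.mem_univ i⟩) ?_)
  rintro _ ⟨x, rfl⟩
  exact diff_basePull_coface i x h

theorem cobdry_sub_mem_lowFaces (φ : Cochain X A (n + 1)) :
    cobdry X A (n + 1) φ - (-1 : ℤ) ^ (n + 2) • (coface X A (n + 1) (Fin.last _) φ -
      coface X A (n + 1) (Fin.last _).castSucc φ) ∈ lowFaces X A (n + 1) (n + 1) := by
  rw [cobdry_apply, Fin.sum_univ_castSucc, Fin.sum_univ_castSucc]
  have h : ∑ i : Fin (n + 1), (-1 : ℤ) ^ (i.castSucc.castSucc : ℕ) •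
      coface X A (n + 1) i.castSucc.castSucc φ ∈ lowFaces X A (n + 1) (n + 1) :=
    sum_mem fun i _ => zsmul_mem (coface_mem_lowFaces (i := i.castSucc.castSucc) i.2 φ) _
  convert h using 1
  simp only [Fin.val_last, Fin.val_castSucc, smul_sub, pow_succ, mul_neg, mul_one, neg_neg,
    neg_smul]
  abel

theorem pullback_jointHom_sub (φ : Cochain X A (n + 1)) :
    pullback A (jointHom X (n + 1)) measurePreserving_jointHom
      (coface X A (n + 1) (Fin.last _) φ - coface X A (n + 1) (Fin.last _).castSucc φ) =
    jointDiff (actingHom X (n + 1) (Fin.last _)) (continuous_actingHom _)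
      (basePull X A (n + 1) φ) := by
  rw [map_sub]
  unfold jointDiff basePull coface
  rw [pullback_pullback, pullback_pullback, pullback_pullback, pullback_pullback]
  congr 1
  · exact pullback_congr (funext faceMap_jointHom_last) _ _ _
  · exact pullback_congr (funext faceMap_jointHom_castSucc_last) _ _ _

theorem map_lowFaces_jointHom :
    (lowFaces X A (n + 1) (n + 1)).map
      (pullback A (jointHom X (n + 1)) measurePreserving_jointHom) =
    coordSum X A (n + 1) (Fin.succ '' Set.univ) := by
  have hface : ∀ j : Fin (n + 1), MeasurePreserving
      ((faceHom X (n + 1) j.castSucc.castSucc).comp (jointHom X (n + 1)))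
      (haarProb (Fin (n + 2) → X)) (haarProb (Fin (n + 1) → X)) := fun j =>
    (faceMap_measurePreserving X (n + 1) j.castSucc.castSucc).comp measurePreserving_jointHom
  have hfc : ∀ j : Fin (n + 1),
      Continuous ((faceHom X (n + 1) j.castSucc.castSucc).comp (jointHom X (n + 1))) := fun j =>
    (faceMap_continuous X (n + 1) j.castSucc.castSucc).comp continuous_jointHom
  have hfs : ∀ j : Fin (n + 1), Function.Surjective
      ((faceHom X (n + 1) j.castSucc.castSucc).comp (jointHom X (n + 1))) := fun j =>
    (faceMap_surjective X (n + 1) j.castSucc.castSucc).comp jointHom_bijective.2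
  apply le_antisymm
  · rw [AddSubgroup.map_le_iff_le_comap]
    refine lowFaces_le fun i hi h => ?_
    obtain ⟨j, rfl⟩ : ∃ j : Fin (n + 1), i = j.castSucc.castSucc := ⟨⟨i, hi⟩, rfl⟩
    obtain ⟨y, hy⟩ := range_pullback_le (A := A) _ (dropHom X (n + 1) j.succ) (hfc j)
      (continuous_dropHom _) (hfs j) (dropHom_surjective _)
      (fun w hw => (faceHom_jointHom_eq_zero_iff j w).2 hw) (hface j)
      (measurePreserving_dropHom _) ⟨h, rfl⟩
    rw [AddSubgroup.mem_comap]
    unfold coface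
    rw [pullback_pullback]
    exact hy ▸ pullback_dropHom_mem (Set.mem_image_of_mem _ (Set.mem_univ j)) y
  · refine coordSum_le ?_
    rintro _ ⟨j, -, rfl⟩ h
    obtain ⟨y, hy⟩ := range_pullback_le (A := A) (dropHom X (n + 1) j.succ) _
      (continuous_dropHom _) (hfc j) (dropHom_surjective _) (hfs j)
      (fun w hw => (faceHom_jointHom_eq_zero_iff j w).1 hw) (measurePreserving_dropHom _)
      (hface j) ⟨h, rfl⟩
    rw [← hy]
    refine ⟨coface X A (n + 1) j.castSucc.castSucc y, coface_mem_lowFaces j.2 y, ?_⟩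
    unfold coface
    rw [pullback_pullback]
    rfl

/-- In the coordinates `jointHom`, the difference of the last two cofaces is the joint diagonal
difference of `f`, and the lower cofaces give the functions independent of some `z_j`. It remains to
treat the diagonal difference first and decompose what the coordinate differences kill. -/
theorem basePull_mem_solutions_iff [T2Space A] [SecondCountableTopology A]
    (φ : Cochain X A (n + 1)) :
    basePull X A (n + 1) φ ∈ solutions A (actingSubgroup X (n + 1)) Finset.univ ↔
      coface X A (n + 1) (Fin.last _) φ - coface X A (n + 1) (Fin.last _).castSucc φ ∈
        lowFaces X A (n + 1) (n + 1) := by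
  set f := basePull X A (n + 1) φ
  have hkey : coface X A (n + 1) (Fin.last _) φ - coface X A (n + 1) (Fin.last _).castSucc φ ∈
        lowFaces X A (n + 1) (n + 1) ↔
      jointDiff (actingHom X (n + 1) (Fin.last _)) (continuous_actingHom _) f ∈
        coordSum X A (n + 1) (Fin.succ '' Set.univ) := by
    rw [← map_lowFaces_jointHom, ← pullback_jointHom_sub]
    exact (AddSubgroup.mem_map_iff_mem (pullback_bijective _ continuous_jointHom
      jointHom_bijective measurePreserving_jointHom).1).symm
  rw [hkey]
  constructor
  · intro hf
    have h1 : IterVanish (actingHom X (n + 1))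
        (Fin.last _ :: (List.finRange (n + 1)).map Fin.castSucc) f := by
      refine iterVanish_of_mem_solutions (actingHom X (n + 1)) ?_ ?_ hf
      · refine List.nodup_cons.2 ⟨?_, (List.nodup_finRange _).map (Fin.castSucc_injective _)⟩
        simp [Fin.castSucc_ne_last]
      · ext k
        induction k using Fin.lastCases <;> simp
    have h2 : IterVanish (AddMonoidHom.single (fun _ : Fin (n + 2) => X))
        ((List.finRange (n + 1)).map Fin.succ)
        (jointDiff (actingHom X (n + 1) (Fin.last _)) (continuous_actingHom _) f) := by
      refine iterVanish_of_slice _ ?_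
      filter_upwards [sliceFun_jointDiff (actingHom X (n + 1) (Fin.last _))
        (continuous_actingHom _) f] with c hc
      rw [hc]
      have h3 := iterVanish_pullback (actingHom X (n + 1))
        (AddMonoidHom.single (fun _ : Fin (n + 1) => X)) Fin.castSucc (AddMonoidHom.id _)
        (MeasurePreserving.id _) (fun i x => by rw [actingHom_castSucc]; rfl) _ (h1 c)
      rwa [pullback_id (φ := AddMonoidHom.id (Fin (n + 1) → X)) rfl] at h3
    refine coordSum_mono ?_ (mem_coordSum_of_iterVanish _
      ((List.nodup_finRange _).map (Fin.succ_injective _)) h2)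
    intro j hj
    obtain ⟨i, _, rfl⟩ := List.mem_map.1 hj
    exact ⟨i, Set.mem_univ i, rfl⟩
  · intro hf
    have hle : coordSum X A n Set.univ ≤
        solutions A (actingSubgroup X (n + 1)) (Finset.univ.erase (Fin.last _)) := by
      refine coordSum_le fun i _ h => mem_solutions_of_singleton _ (i := i.castSucc)
        (Finset.mem_erase.2 ⟨Fin.castSucc_ne_last i, Finset.mem_univ _⟩) ?_
      rintro _ ⟨x, rfl⟩
      refine diff_pullback_eq_zero _ _ ?_ h
      rw [actingHom_castSucc]
      exact dropHom_single i x
    refine mem_solutions_of_diff_mem _ (Finset.mem_univ (Fin.last _)) ?_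
    rintro _ ⟨x, rfl⟩
    -- Slicing controls only almost every diagonal shift, whereas the equation is required for all
    -- of them.
    refine diff_mem_solutions_of_ae _ (actingHom X (n + 1) (Fin.last _)) ?_ x
    filter_upwards [ae_slice.1 (slice_mem_coordSum hf), sliceFun_jointDiff
      (actingHom X (n + 1) (Fin.last _)) (continuous_actingHom _) f] with c hc hc'
    rw [← hc']
    exact hle hc

theorem basePull_mem_solutions [T2Space A] [SecondCountableTopology A] {φ : Cochain X A (n + 1)}
    (hφ : φ ∈ cocycles X A (n + 1)) :
    basePull X A (n + 1) φ ∈ solutions A (actingSubgroup X (n + 1)) Finset.univ := by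
  rw [basePull_mem_solutions_iff]
  have h := zsmul_mem (cobdry_sub_mem_lowFaces φ) ((-1 : ℤ) ^ (n + 2))
  rw [show cobdry X A (n + 1) φ = 0 from hφ, zero_sub, smul_neg, smul_smul, ← mul_pow] at h
  simpa using neg_mem h

variable (X A) in
/-- The solution classes defined by cocycles. -/
def cocycleClass [T2Space A] [SecondCountableTopology A] (n : ℕ) : cocycles X A (n + 1) →+
    solutions A (actingSubgroup X (n + 1)) Finset.univ ⧸
      degenerate A (actingSubgroup X (n + 1)) :=
  (QuotientAddGroup.mk' _).comp
    (((basePull X A (n + 1)).comp (cocycles X A (n + 1)).subtype).codRestrict _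
      fun φ => basePull_mem_solutions φ.2)

theorem mem_degenerate_iff [T2Space A] [SecondCountableTopology A]
    (f : solutions A (actingSubgroup X (n + 1)) Finset.univ) :
    f ∈ degenerate A (actingSubgroup X (n + 1)) ↔
      (f : MeasFun (Fin (n + 1) → X) A) ∈
        (lowFaces X A n (n + 2)).map (basePull X A (n + 1)) := by
  rw [← map_degenerate_actingSubgroup]
  exact (AddSubgroup.mem_map_iff_mem (AddSubgroup.subtype_injective _)).symm

theorem cocycleClass_surjective [T2Space A] [SecondCountableTopology A] :
    Function.Surjective (cocycleClass X A n) := by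
  intro q
  obtain ⟨⟨f, hf⟩, rfl⟩ := QuotientAddGroup.mk'_surjective _ q
  obtain ⟨φ, rfl⟩ := basePull_bijective.2 f
  have h1 := (basePull_mem_solutions_iff φ).1 hf
  have h2 : cobdry X A (n + 1) φ ∈ lowFaces X A (n + 1) (n + 2) := by
    have h3 := add_mem (cobdry_sub_mem_lowFaces φ) (zsmul_mem h1 ((-1 : ℤ) ^ (n + 2)))
    rw [sub_add_cancel] at h3
    exact lowFaces_mono (Nat.le_succ _) h3
  obtain ⟨y, hy, hyφ⟩ := exists_cobdry_eq le_rfl h2 (cobdry_cobdry φ)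
  have hz : φ - y ∈ cocycles X A (n + 1) := by
    change cobdry X A (n + 1) (φ - y) = 0
    rw [map_sub, hyφ, sub_self]
  refine ⟨⟨φ - y, hz⟩, ?_⟩
  refine (QuotientAddGroup.eq).2 ?_
  rw [mem_degenerate_iff]
  refine ⟨y, lowFaces_mono (Nat.le_succ _) hy, ?_⟩
  change basePull X A (n + 1) y = -basePull X A (n + 1) (φ - y) + basePull X A (n + 1) φ
  rw [map_sub]
  abel

/-- Modulo the other cofaces, `δ^last h` is `±` the coboundary of `h`, so a degenerate cocycle is a
coboundary plus a closed element of the acyclic subcomplex. The shift to degree `n + 2` is where `d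
≥ 2` enters. -/
theorem ker_cocycleClass [T2Space A] [SecondCountableTopology A] :
    (cocycleClass X A (n + 1)).ker =
      (coboundaries X A (n + 2)).addSubgroupOf (cocycles X A (n + 2)) := by
  ext ⟨φ, hφ⟩
  have h1 : (⟨φ, hφ⟩ : cocycles X A (n + 2)) ∈ (cocycleClass X A (n + 1)).ker ↔
      φ ∈ lowFaces X A (n + 1) (n + 3) := by
    rw [AddMonoidHom.mem_ker]
    refine (QuotientAddGroup.eq_zero_iff _).trans ?_
    rw [mem_degenerate_iff]
    exact AddSubgroup.mem_map_iff_mem basePull_bijective.1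
  rw [h1, AddSubgroup.mem_addSubgroupOf]
  change φ ∈ lowFaces X A (n + 1) (n + 3) ↔ φ ∈ (cobdry X A (n + 1)).range
  have hd : ∀ h : Cochain X A (n + 1), cobdry X A (n + 1) h -
      (-1 : ℤ) ^ (n + 2) • coface X A (n + 1) (Fin.last _) h ∈ lowFaces X A (n + 1) (n + 2) := by
    intro h
    rw [cobdry_apply, Fin.sum_univ_castSucc, Fin.val_last, add_sub_cancel_right]
    exact sum_mem fun i _ => zsmul_mem (coface_mem_lowFaces (i := i.castSucc) i.2 h) _
  constructor
  · intro hmem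
    obtain ⟨h, y, hy, rfl⟩ := exists_of_mem_lowFaces_succ (Fin.last (n + 2)) hmem
    have hy : y ∈ lowFaces X A (n + 1) (n + 2) := hy
    set s : ℤ := (-1 : ℤ) ^ (n + 2) with hs
    have hss : s * s = 1 := by rw [hs, ← mul_pow]; simp
    have h2 : coface X A (n + 1) (Fin.last _) h + y - s • cobdry X A (n + 1) h ∈
        lowFaces X A (n + 1) (n + 2) := by
      have h3 := sub_mem hy (zsmul_mem (hd h) s)
      rw [smul_sub, smul_smul, hss, one_smul] at h3
      convert h3 using 1
      abel
    obtain ⟨z, _, hz⟩ := exists_cobdry_eq le_rfl h2 (by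
      rw [map_sub, map_zsmul, cobdry_cobdry, smul_zero, sub_zero]
      exact hφ)
    exact ⟨z + s • h, by rw [map_add, hz, map_zsmul, sub_add_cancel]⟩
  · rintro ⟨h, rfl⟩
    have h2 := add_mem (lowFaces_mono (Nat.le_succ _) (hd h)) (zsmul_mem (coface_mem_lowFaces
      (j := n + 3) (i := Fin.last (n + 2)) (Fin.is_lt _) h) ((-1 : ℤ) ^ (n + 2)))
    rwa [sub_add_cancel] at h2

end Main

end PDE

end

theorem mainTheorem9
    {Z₀ : Type*} [AddCommGroup Z₀] [TopologicalSpace Z₀] [IsTopologicalAddGroup Z₀]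
    [CompactSpace Z₀] [T2Space Z₀] [SecondCountableTopology Z₀]
    [MeasurableSpace Z₀] [BorelSpace Z₀]
    {A : Type*} [AddCommGroup A] [TopologicalSpace A] [IsTopologicalAddGroup A]
    [T2Space A] [SecondCountableTopology A] (hA : PDE.IsLocallyEuclidean A)
    (d : ℕ) (hd : 2 ≤ d) :
    PDE.SubgroupsAlmostIndependent (PDE.actingSubgroup Z₀ d) ∧
    (∀ i : Fin (d + 1), ∃ e : (Fin d → Z₀) ≃ₜ+ (Fin d → Z₀),
      ∀ w : Fin d → Z₀, e w = ∑ j : Fin d, PDE.actingHom Z₀ d (i.succAbove j) (w j)) ∧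
    Nonempty
      ((PDE.solutions A (PDE.actingSubgroup Z₀ d) Finset.univ ⧸
          PDE.degenerate A (PDE.actingSubgroup Z₀ d)) ≃+
        PDE.MeasCohomology Z₀ A d) := by
  refine ⟨PDE.actingSubgroup_almostIndependent Z₀ d, PDE.exists_continuousAddEquiv, ?_⟩
  obtain ⟨n, rfl⟩ : ∃ n, d = n + 2 := ⟨d - 2, by omega⟩
  exact ⟨((QuotientAddGroup.quotientAddEquivOfEq
      (PDE.ker_cocycleClass (X := Z₀) (A := A) (n := n)).symm).trans
    (QuotientAddGroup.quotientKerEquivOfSurjective (PDE.cocycleClass Z₀ A (n + 1))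
      PDE.cocycleClass_surjective)).symm⟩
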